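/- Let $N\ge 1$, let $B_r\subset\mathbb R^N$ be the open ball of radius $r$ centred at the origin, and let $\sigma>0$. For $0<a<1$ put $b=(1-a^N)^{1/N}$, so that $|B_a|+|B_b|=|B_1|$, and define the two-ball energy \[ \mathcal E(a,\sigma)=\min\Big(\tfrac12\int_{B_a}|\Delta f|^2-\tfrac{\sigma^2}{2}\int_{B_a}|\nabla f|^2-\int_{B_a}f+\tfrac12\int_{B_b}|\Delta g|^2-\tfrac{\sigma^2}{2}\int_{B_b}|\nabla g|^2\Big), \] where the minimum is over all pairs $f\in H^1_0\cap H^2(B_a)$, $g\in H^1_0\cap H^2(B_b)$ whose outward normal derivatives on the boundary spheres are constant (in the sense of traces) and satisfy \[ a^{N-1}\,\frac{\partial f}{\partial n}\Big|_{\partial B_a}=b^{N-1}\,\frac{\partial g}{\partial n}\Big|_{\partial B_b}. \] For $a=1$ the second ball is absent, and \[ \mathcal E(1,\sigma)=\min_{f\in H^2_0(B_1)}\Big(\tfrac12\int_{B_1}|\Delta f|^2-\tfrac{\sigma^2}{2}\int_{B_1}|\nabla f|^2-\int_{B_1}f\Big). \] Then there exists $\sigma_N>0$, depending only on $N$, such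 that for all $0<\sigma\le\sigma_N$ these minima are attained for every $a\in(0,1]$, and the (left) derivative of $a\mapsto\mathcal E(a,\sigma)$ at $a=1$ exists and equals zero: \[ \frac{\partial}{\partial a}\mathcal E(a,\sigma)\Big|_{a=1}=0 . \] -/

import Mathlib

open MeasureTheory Filter Topology TopologicalSpace
open scoped Distributions ContDiff

noncomputable section

namespace TwoBall

/-- Euclidean space of dimension `N`. -/
abbrev Euc (N : ℕ) : Type := EuclideanSpace ℝ (Fin N)

/-- The classical partial derivative in the `i`-th coordinate direction. -/
def partialDeriv {N : ℕ} (i : Fin N) (φ : Euc N → ℝ) (x : Euc N) : ℝ :=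
  fderiv ℝ φ x (EuclideanSpace.single i 1)

/-- The open ball of radius `r` centred at the origin, as an open set. -/
def ball0 (N : ℕ) (r : ℝ) : Opens (Euc N) :=
  ⟨Metric.ball (0 : Euc N) r, Metric.isOpen_ball⟩

/-- `w` is the weak partial derivative of `v` in the `i`-th direction on `U` (to be used for locally
integrable `v` and `w`): `∫_U v ∂ᵢφ = - ∫_U w φ` for all smooth `φ` with compact support in `U`. -/
def IsWeakPartial {N : ℕ} (U : Opens (Euc N)) (i : Fin N) (v w : Euc N → ℝ) : Prop :=
  ∀ φ : 𝓓(U, ℝ), ∫ x in U, v x * partialDeriv i φ x = - ∫ x in U, w x * φ x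

/-- An element of the Sobolev space `H²(U)`: a square-integrable function on `U`, together with its
weak first and second partial derivatives, which are square-integrable on `U`. (The derivatives are
determined by `toFun` up to null sets. Values outside `U` are irrelevant.) -/
structure H2Function {N : ℕ} (U : Opens (Euc N)) where
  toFun : Euc N → ℝ
  grad : Fin N → Euc N → ℝ
  hess : Fin N → Fin N → Euc N → ℝ
  memLp_toFun : MemLp toFun 2 (volume.restrict (U : Set (Euc N)))
  memLp_grad : ∀ i, MemLp (grad i) 2 (volume.restrict (U : Set (Euc N)))
  memLp_hess : ∀ i j, MemLp (hess i j) 2 (volume.restrict (U : Set (Euc N)))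
  isWeakPartial_grad : ∀ i, IsWeakPartial U i toFun (grad i)
  isWeakPartial_hess : ∀ i j, IsWeakPartial U j (grad i) (hess i j)

namespace H2Function

variable {N : ℕ} {U : Opens (Euc N)}

/-- The Laplacian `Δu`. -/
def laplacian (u : H2Function U) (x : Euc N) : ℝ := ∑ i, u.hess i i x

/-- `u ∈ H¹₀(U)`: `u` is a limit in `H¹(U)` of smooth functions with compact support in `U`. -/
def MemH10 (u : H2Function U) : Prop :=
  ∃ φ : ℕ → 𝓓(U, ℝ),
    Tendsto (fun n => eLpNorm (fun x => φ n x - u.toFun x) 2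
      (volume.restrict (U : Set (Euc N)))) atTop (𝓝 0) ∧
    ∀ i, Tendsto (fun n => eLpNorm (fun x => partialDeriv i (φ n) x - u.grad i x) 2
      (volume.restrict (U : Set (Euc N)))) atTop (𝓝 0)

/-- `u ∈ H²₀(U)`: `u` is a limit in `H²(U)` of smooth functions with compact support in `U`. -/
def MemH20 (u : H2Function U) : Prop :=
  ∃ φ : ℕ → 𝓓(U, ℝ),
    Tendsto (fun n => eLpNorm (fun x => φ n x - u.toFun x) 2
      (volume.restrict (U : Set (Euc N)))) atTop (𝓝 0) ∧
    (∀ i, Tendsto (fun n => eLpNorm (fun x => partialDeriv i (φ n) x - u.grad i x) 2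
      (volume.restrict (U : Set (Euc N)))) atTop (𝓝 0)) ∧
    ∀ i j, Tendsto (fun n => eLpNorm
      (fun x => partialDeriv j (partialDeriv i (φ n)) x - u.hess i j x) 2
      (volume.restrict (U : Set (Euc N)))) atTop (𝓝 0)

/-- The plate energy
`½ ∫_U |Δu|² - (σ²/2) ∫_U |∇u|² - α ∫_U u` with compression `σ` and constant load `α`. -/
def plateEnergy (σ α : ℝ) (u : H2Function U) : ℝ :=
  (1 / 2) * (∫ x in U, u.laplacian x ^ 2)
    - (σ ^ 2 / 2) * (∫ x in U, ∑ i, u.grad i x ^ 2)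
    - α * ∫ x in U, u.toFun x

end H2Function

/-- The integral `∫_{∂B_r} φ dS` over the sphere of radius `r` centred at the origin, with respect
to surface measure. -/
def sphereIntegral (N : ℕ) (r : ℝ) (φ : Euc N → ℝ) : ℝ :=
  r ^ (N - 1) * ∫ θ : Metric.sphere (0 : Euc N) 1, φ (r • (θ : Euc N))
    ∂(volume : Measure (Euc N)).toSphere

/-- The outward normal derivative `∂u/∂n` of `u ∈ H²(B_r)` is equal to the constant `c` on `∂B_r`,
in the sense of traces: Green's formula `∫_{B_r} (φ Δu + ∇φ · ∇u) = ∫_{∂B_r} c φ dS` holds for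
all smooth `φ`. -/
def HasNormalDeriv {N : ℕ} {r : ℝ} (u : H2Function (ball0 N r)) (c : ℝ) : Prop :=
  ∀ φ : Euc N → ℝ, ContDiff ℝ ∞ φ →
    ∫ x in ball0 N r, (φ x * u.laplacian x + ∑ i, partialDeriv i φ x * u.grad i x)
      = sphereIntegral N r (fun x => c * φ x)

/-- The radius `b` with `a ^ N + b ^ N = 1`, so that `|B_a| + |B_b| = |B_1|`. -/
def radiusB (N : ℕ) (a : ℝ) : ℝ := (1 - a ^ N) ^ (1 / (N : ℝ))

/-- Admissible pairs of the two-ball problem: `f ∈ H¹₀ ∩ H²(B_a)`, `g ∈ H¹₀ ∩ H²(B_b)`, with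
constant normal derivatives that satisfy `a^(N-1) ∂f/∂n = b^(N-1) ∂g/∂n`. -/
def Admissible {N : ℕ} {a b : ℝ} (f : H2Function (ball0 N a)) (g : H2Function (ball0 N b)) :
    Prop :=
  f.MemH10 ∧ g.MemH10 ∧
    ∃ p q : ℝ, HasNormalDeriv f p ∧ HasNormalDeriv g q ∧ a ^ (N - 1) * p = b ^ (N - 1) * q

/-- The values that are minimized in the two-ball problem. For `0 < a < 1` these are the energies of
admissible pairs, with load `1` on `B_a` and load `0` on `B_b`. For `a = 1` the second
ball is absent, and these are the energies of the clamped plates `f ∈ H²₀(B_1)`. -/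
def energyValues (N : ℕ) (a σ : ℝ) : Set ℝ :=
  if a < 1 then
    {e | ∃ (f : H2Function (ball0 N a)) (g : H2Function (ball0 N (radiusB N a))),
      Admissible f g ∧ e = f.plateEnergy σ 1 + g.plateEnergy σ 0}
  else
    {e | ∃ f : H2Function (ball0 N 1), f.MemH20 ∧ e = f.plateEnergy σ 1}

/-- The two-ball energy `𝓔(a, σ)`. -/
def twoBallEnergy (N : ℕ) (a σ : ℝ) : ℝ := sInf (energyValues N a σ)

end TwoBall

end

/-! For small `σ` the quadratic part of the energy is nonnegative on `H¹₀ ∩ H²`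
(`MemH10.quadratic_nonneg`, from Poincaré's inequality), so any critical point is a minimizer and it
is enough to exhibit one. The critical equations are `Δ²f + σ²Δf = 1`, `Δ²g + σ²Δg = 0`. Varying the
common flux `a^(N-1) ∂f/∂n = b^(N-1) ∂g/∂n` adds the natural condition that the boundary values of
`Δf` and `Δg` sum to zero. All of this is solved by radial functions `c‖x‖² + d + β J(σ²‖x‖²)`, with
`J` a normalized Bessel function. Natural condition and flux constraint form a linear system for the
two Bessel coefficients, solvable because `J` and `K = -2N J'` are positive on `[0, σ²]`.

At the critical point the boundary terms of the two balls cancel, so the energy is `-½ ∫ f`, which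
is explicit in `a`. At `a = 1` the same formula gives the clamped plate, whose normal derivative is
zero.

The derivative at `a = 1` vanishes for two reasons. First, the Bessel coefficient `β` of `f` is
stationary there: the second ball enters `β` only through `(1 - a^N) K/J`, where `K/J` is continuous
and tends to `1`, and the first-order terms of numerator and denominator both cancel. Second, with
`c` and `β` frozen, the derivative of `∫_{B_r} (h(|x|) - h(r)) dx` in `r` is `-h'(r)|B_r|`, which is
zero at `r = 1` by the clamping condition. -/

noncomputable section

namespace TwoBall

/-! ### A normalized Bessel function -/

/-- The coefficients of the power series of `normBessel`. -/
def besselCoeff (ν : ℝ) (k : ℕ) : ℝ :=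
  (-1 / 4) ^ k / (k.factorial * ∏ j ∈ Finset.range k, (ν + j))

/-- The entire function `∑ (-t/4)^k / (k! (ν)_k)`, a normalized Bessel function in the squared
variable: `x ↦ normBessel (N / 2) (‖x‖ ^ 2)` solves `Δu = -u` on `ℝ^N`. -/
def normBessel (ν t : ℝ) : ℝ := ∑' k, besselCoeff ν k * t ^ k

lemma prod_range_add_pos {ν : ℝ} (hν : 0 < ν) (k : ℕ) : 0 < ∏ j ∈ Finset.range k, (ν + j) :=
  Finset.prod_pos fun j _ => by positivity

lemma half_pow_le_prod_range_add {ν : ℝ} (hν : 1 / 2 ≤ ν) (k : ℕ) :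
    (1 / 2 : ℝ) ^ k ≤ ∏ j ∈ Finset.range k, (ν + j) := by
  calc (1 / 2 : ℝ) ^ k = ∏ j ∈ Finset.range k, (1 / 2 : ℝ) := by simp
    _ ≤ _ := Finset.prod_le_prod (fun _ _ => by norm_num) fun j _ => by
      have : (0 : ℝ) ≤ j := j.cast_nonneg
      linarith

lemma abs_besselCoeff_le {ν : ℝ} (hν : 1 / 2 ≤ ν) (k : ℕ) :
    |besselCoeff ν k| ≤ (1 / 2) ^ k / k.factorial := by
  have h1 := half_pow_le_prod_range_add hν k
  have h2 := prod_range_add_pos (show 0 < ν by linarith) k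
  have h3 : (0 : ℝ) < k.factorial := by positivity
  rw [besselCoeff, abs_div, abs_of_pos (mul_pos h3 h2), abs_pow, div_le_div_iff₀ (by positivity) h3]
  have h4 : |(-1 / 4 : ℝ)| ^ k = (1 / 2) ^ k * (1 / 2) ^ k := by
    rw [← mul_pow]; norm_num [abs_of_neg]
  rw [h4]
  have : (0 : ℝ) < (1 / 2) ^ k := by positivity
  nlinarith [mul_le_mul_of_nonneg_left h1 (mul_pos this h3).le]

lemma summable_besselCoeff {ν : ℝ} (hν : 1 / 2 ≤ ν) (t : ℝ) :
    Summable fun k => |besselCoeff ν k * t ^ k| := by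
  refine Summable.of_nonneg_of_le (fun _ => abs_nonneg _) (fun k => ?_)
    (Real.summable_pow_div_factorial (|t| / 2))
  rw [abs_mul, abs_pow]
  calc _ ≤ (1 / 2) ^ k / k.factorial * |t| ^ k := by gcongr; exact abs_besselCoeff_le hν k
    _ = _ := by rw [div_pow, div_pow]; ring

lemma succ_mul_besselCoeff_succ {ν : ℝ} (hν : 0 < ν) (k : ℕ) :
    besselCoeff ν (k + 1) * (k + 1) = -1 / (4 * ν) * besselCoeff (ν + 1) k := by
  have h : ∏ j ∈ Finset.range (k + 1), (ν + j) = ν * ∏ j ∈ Finset.range k, (ν + 1 + j) := by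
    rw [Finset.prod_range_succ', mul_comm]
    simp only [Nat.cast_zero, add_zero, Nat.cast_add, Nat.cast_one]
    congr 1
    exact Finset.prod_congr rfl fun _ _ => by ring
  have h2 := prod_range_add_pos (show 0 < ν + 1 by linarith) k
  rw [besselCoeff, besselCoeff, h, Nat.factorial_succ]
  push_cast
  field_simp
  ring

/-- Coefficient form of the three-term contiguity relation in the order `ν`. All rising factorials
are expressed through the one starting at `ν + 2`. -/
lemma besselCoeff_succ_eq {ν : ℝ} (hν : 0 < ν) (k : ℕ) :
    besselCoeff ν (k + 1) = besselCoeff (ν + 1) (k + 1)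
      - 1 / (4 * ν * (ν + 1)) * besselCoeff (ν + 2) k := by
  have h (μ : ℝ) : ∏ j ∈ Finset.range (k + 1), (μ + j) = μ * ∏ j ∈ Finset.range k, (μ + 1 + j) := by
    rw [Finset.prod_range_succ', mul_comm]
    simp only [Nat.cast_zero, add_zero, Nat.cast_add, Nat.cast_one]
    congr 1
    exact Finset.prod_congr rfl fun _ _ => by ring
  have h2 := prod_range_add_pos (show 0 < ν + 2 by linarith) k
  have h3 := prod_range_add_pos (show 0 < ν + 1 by linarith) k
  have h4 : (ν + 1 + k) * ∏ j ∈ Finset.range k, (ν + 1 + j)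
      = (ν + 1) * ∏ j ∈ Finset.range k, (ν + 2 + j) := by
    have := h (ν + 1)
    rw [Finset.prod_range_succ, show ν + 1 + 1 = ν + 2 by ring] at this
    linarith
  have h5 : ∏ j ∈ Finset.range k, (ν + 1 + j)
      = (ν + 1) * (∏ j ∈ Finset.range k, (ν + 2 + j)) / (ν + 1 + k) := by
    field_simp; linarith
  rw [besselCoeff, besselCoeff, besselCoeff, h, h, h5, Nat.factorial_succ,
    show ν + 1 + 1 = ν + 2 by ring]
  push_cast
  field_simp
  ring

/-- Termwise differentiation on a ball containing `t`. After an index shift the differentiated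
series is a multiple of the series of order `ν + 1`, which also supplies the summable majorant. -/
lemma hasDerivAt_normBessel {ν : ℝ} (hν : 1 / 2 ≤ ν) (t : ℝ) :
    HasDerivAt (normBessel ν) (-1 / (4 * ν) * normBessel (ν + 1) t) t := by
  set R := |t| + 1
  have hR : 0 ≤ R := by positivity
  have hν0 : 0 < ν := by linarith
  have key (x : ℝ) (k : ℕ) : besselCoeff ν (k + 1) * (((k + 1 : ℕ) : ℝ) * x ^ (k + 1 - 1))
      = -1 / (4 * ν) * (besselCoeff (ν + 1) k * x ^ k) := by
    rw [← mul_assoc (-1 / (4 * ν)), ← succ_mul_besselCoeff_succ hν0]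
    rw [Nat.add_sub_cancel]; push_cast; ring
  have hsum : Summable fun k => |besselCoeff ν k * ((k : ℝ) * R ^ (k - 1))| := by
    rw [← summable_nat_add_iff 1]
    simp_rw [key, abs_mul (-1 / (4 * ν))]
    exact (summable_besselCoeff (by linarith) R).mul_left _
  have hd := hasDerivAt_tsum_of_isPreconnected (𝕜 := ℝ) (t := Metric.ball (0 : ℝ) R)
    (g := fun k x => besselCoeff ν k * x ^ k)
    (g' := fun k x => besselCoeff ν k * ((k : ℝ) * x ^ (k - 1))) hsum Metric.isOpen_ball
    (convex_ball _ _).isPreconnected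
    (fun k y _ => (hasDerivAt_pow k y).const_mul _)
    (fun k y hy => by
      rw [mem_ball_zero_iff, Real.norm_eq_abs] at hy
      rw [Real.norm_eq_abs, abs_mul, abs_mul, abs_mul (besselCoeff ν k), abs_mul (k : ℝ), abs_pow,
        abs_pow, abs_of_nonneg hR]
      gcongr)
    (y₀ := 0) (by simp [R]; positivity) (summable_besselCoeff hν 0).of_abs
    (y := t) (by simp [R])
  convert! hd using 1
  rw [Summable.tsum_eq_zero_add]
  · simp_rw [key, tsum_mul_left, normBessel]; simp
  · refine Summable.of_norm_bounded hsum fun k => ?_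
    rw [Real.norm_eq_abs, abs_mul, abs_mul, abs_mul (besselCoeff ν k), abs_mul (k : ℝ), abs_pow,
        abs_pow, abs_of_nonneg hR]
    gcongr
    simp [R]

lemma normBessel_recurrence {ν : ℝ} (hν : 1 / 2 ≤ ν) (t : ℝ) :
    normBessel ν t = normBessel (ν + 1) t - t / (4 * ν * (ν + 1)) * normBessel (ν + 2) t := by
  have hs (μ : ℝ) (hμ : 1 / 2 ≤ μ) := (summable_besselCoeff hμ t).of_abs
  have h0 (μ : ℝ) : besselCoeff μ 0 = 1 := by simp [besselCoeff]
  rw [normBessel, normBessel, normBessel, (hs ν hν).tsum_eq_zero_add,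
    (hs (ν + 1) (by linarith)).tsum_eq_zero_add, h0, h0, add_sub_assoc, ← tsum_mul_left,
    ← Summable.tsum_sub]
  · congr 1
    refine tsum_congr fun k => ?_
    rw [besselCoeff_succ_eq (by linarith)]
    ring
  · exact (summable_nat_add_iff 1).2 (hs (ν + 1) (by linarith))
  · exact (hs (ν + 2) (by linarith)).mul_left _

lemma normBessel_zero (ν : ℝ) : normBessel ν 0 = 1 := by
  rw [normBessel, tsum_eq_single 0]
  · simp [besselCoeff]
  · intro k hk; simp [hk]

/-- Each derivative raises the order by one, so the induction must run over all `ν` at once. -/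
lemma contDiff_normBessel {ν : ℝ} (hν : 1 / 2 ≤ ν) : ContDiff ℝ ∞ (normBessel ν) := by
  rw [contDiff_infty]
  intro n
  induction n generalizing ν with
  | zero =>
    exact contDiff_zero.2 (continuous_iff_continuousAt.2 fun t =>
      (hasDerivAt_normBessel hν t).continuousAt)
  | succ n ih =>
    push_cast
    rw [contDiff_succ_iff_deriv]
    refine ⟨fun t => (hasDerivAt_normBessel hν t).differentiableAt, by simp, ?_⟩
    rw [funext fun t => (hasDerivAt_normBessel hν t).deriv]
    exact contDiff_const.mul (ih (by linarith))

variable {N : ℕ}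

/-! ### Partial derivatives of smooth functions -/

lemma ContDiff.partialDeriv {u : Euc N → ℝ} (hu : ContDiff ℝ ∞ u) (i : Fin N) :
    ContDiff ℝ ∞ (partialDeriv i u) :=
  (hu.fderiv_right (m := ∞) (by simp)).clm_apply contDiff_const

/-- The classical Laplacian. -/
def lap (u : Euc N → ℝ) (x : Euc N) : ℝ := ∑ i, partialDeriv i (partialDeriv i u) x

lemma ContDiff.lap {u : Euc N → ℝ} (hu : ContDiff ℝ ∞ u) : ContDiff ℝ ∞ (lap u) :=
  ContDiff.sum fun i _ => ContDiff.partialDeriv (ContDiff.partialDeriv hu i) i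

lemma HasCompactSupport.partialDeriv {u : Euc N → ℝ} (hu : HasCompactSupport u) (i : Fin N) :
    HasCompactSupport (partialDeriv i u) :=
  hu.fderiv_apply ℝ _

lemma tsupport_partialDeriv_subset (u : Euc N → ℝ) (i : Fin N) :
    tsupport (partialDeriv i u) ⊆ tsupport u :=
  tsupport_fderiv_apply_subset ℝ _

lemma partialDeriv_comp_sq_norm {F : ℝ → ℝ} (hF : ContDiff ℝ ∞ F) (i : Fin N) (x : Euc N) :
    partialDeriv i (fun x => F (‖x‖ ^ 2)) x = 2 * x i * deriv F (‖x‖ ^ 2) := by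
  have h1 : HasFDerivAt (fun x : Euc N => ‖x‖ ^ 2) (2 • innerSL ℝ x) x :=
    (hasStrictFDerivAt_norm_sq x).hasFDerivAt
  have h2 : HasDerivAt F (deriv F (‖x‖ ^ 2)) (‖x‖ ^ 2) :=
    ((hF.differentiable (by simp)) _).hasDerivAt
  have h3 : HasFDerivAt (fun x : Euc N => F (‖x‖ ^ 2)) _ x := h2.comp_hasFDerivAt x h1
  rw [partialDeriv, h3.fderiv]
  simp [EuclideanSpace.inner_single_right]
  ring

lemma contDiff_comp_sq_norm {F : ℝ → ℝ} (hF : ContDiff ℝ ∞ F) :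
    ContDiff ℝ ∞ (fun x : Euc N => F (‖x‖ ^ 2)) :=
  hF.comp (contDiff_norm_sq ℝ)

lemma contDiff_deriv_of_contDiff {F : ℝ → ℝ} (hF : ContDiff ℝ ∞ F) : ContDiff ℝ ∞ (deriv F) :=
  (contDiff_infty_iff_deriv.1 hF).2

lemma hasFDerivAt_coord (i : Fin N) (x : Euc N) :
    HasFDerivAt (fun x : Euc N => x i) (EuclideanSpace.proj i : Euc N →L[ℝ] ℝ) x :=
  (EuclideanSpace.proj i : Euc N →L[ℝ] ℝ).hasFDerivAt

lemma contDiff_coord (i : Fin N) : ContDiff ℝ ∞ (fun x : Euc N => x i) :=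
  (EuclideanSpace.proj i : Euc N →L[ℝ] ℝ).contDiff

lemma partialDeriv_coord (i j : Fin N) (x : Euc N) :
    partialDeriv j (fun x => x i) x = if i = j then 1 else 0 := by
  rw [partialDeriv, (hasFDerivAt_coord i x).fderiv]
  simp

lemma partialDeriv_mul {u v : Euc N → ℝ} {x : Euc N} (hu : DifferentiableAt ℝ u x)
    (hv : DifferentiableAt ℝ v x) (i : Fin N) :
    partialDeriv i (fun x => u x * v x) x = partialDeriv i u x * v x + u x * partialDeriv i v x := by
  simp only [partialDeriv]
  rw [fderiv_fun_mul hu hv]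
  simp
  ring

lemma partialDeriv_partialDeriv_comp_sq_norm {F : ℝ → ℝ} (hF : ContDiff ℝ ∞ F) (i j : Fin N)
    (x : Euc N) :
    partialDeriv j (partialDeriv i (fun x => F (‖x‖ ^ 2))) x
      = 4 * x i * x j * deriv (deriv F) (‖x‖ ^ 2) + if i = j then 2 * deriv F (‖x‖ ^ 2) else 0 := by
  have hF' := contDiff_deriv_of_contDiff hF
  have h : partialDeriv i (fun x : Euc N => F (‖x‖ ^ 2))
      = fun x => x i * (fun t => 2 * deriv F t) (‖x‖ ^ 2) := by
    ext x
    rw [partialDeriv_comp_sq_norm hF]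
    ring
  have h2 : ContDiff ℝ ∞ fun t => 2 * deriv F t := contDiff_const.mul hF'
  rw [h, partialDeriv_mul ((contDiff_coord i).differentiable (by simp) x)
    ((contDiff_comp_sq_norm h2).differentiable (by simp) x), partialDeriv_coord,
    partialDeriv_comp_sq_norm h2, deriv_const_mul _ (hF'.differentiable (by simp) _)]
  split_ifs <;> ring

lemma sum_sq_coord (x : Euc N) : ∑ i, x i * x i = ‖x‖ ^ 2 := by
  rw [EuclideanSpace.norm_sq_eq]
  exact Finset.sum_congr rfl fun i _ => by rw [Real.norm_eq_abs, sq_abs, sq]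

lemma lap_comp_sq_norm {F : ℝ → ℝ} (hF : ContDiff ℝ ∞ F) (x : Euc N) :
    lap (fun x => F (‖x‖ ^ 2)) x
      = 4 * ‖x‖ ^ 2 * deriv (deriv F) (‖x‖ ^ 2) + 2 * N * deriv F (‖x‖ ^ 2) := by
  simp only [lap, partialDeriv_partialDeriv_comp_sq_norm hF, if_true, Finset.sum_add_distrib]
  rw [← Finset.sum_mul, ← sum_sq_coord, Finset.mul_sum]
  simp [mul_assoc]
  ring

lemma fderiv_apply_eq_sum_partialDeriv (u : Euc N → ℝ) (x v : Euc N) :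
    fderiv ℝ u x v = ∑ i, v i * partialDeriv i u x := by
  conv_lhs => rw [← (EuclideanSpace.basisFun (Fin N) ℝ).sum_repr v]
  simp [partialDeriv]

/-! ### Integration by parts -/

lemma setIntegral_mul_partialDeriv (U : Opens (Euc N)) {v : Euc N → ℝ} (hv : ContDiff ℝ ∞ v)
    (i : Fin N) (φ : 𝓓(U, ℝ)) :
    ∫ x in U, v x * partialDeriv i φ x = - ∫ x in U, partialDeriv i v x * φ x := by
  have hφ : ContDiff ℝ ∞ φ := φ.contDiff
  have hs : ∀ x, x ∉ (U : Set (Euc N)) → x ∉ tsupport φ := fun x hx h => hx (φ.tsupport_subset h)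
  rw [setIntegral_eq_integral_of_forall_compl_eq_zero,
    setIntegral_eq_integral_of_forall_compl_eq_zero]
  · refine integral_mul_fderiv_eq_neg_fderiv_mul_of_integrable ?_ ?_ ?_
      (fun x _ => hv.differentiable (by simp) x) fun x _ => hφ.differentiable (by simp) x
    · exact Continuous.integrable_of_hasCompactSupport
        ((ContDiff.partialDeriv hv i).continuous.mul hφ.continuous) φ.hasCompactSupport.mul_left
    · exact Continuous.integrable_of_hasCompactSupport
        (hv.continuous.mul (ContDiff.partialDeriv hφ i).continuous)
        (HasCompactSupport.partialDeriv φ.hasCompactSupport i).mul_left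
    · exact Continuous.integrable_of_hasCompactSupport
        (hv.continuous.mul hφ.continuous) φ.hasCompactSupport.mul_left
  · intro x hx
    rw [image_eq_zero_of_notMem_tsupport (hs x hx), mul_zero]
  · intro x hx
    rw [image_eq_zero_of_notMem_tsupport fun h => hs x hx (tsupport_partialDeriv_subset _ i h),
      mul_zero]

/-! ### Integration in polar coordinates -/

lemma setIntegral_ball_eq_integral_sphere (hN : 1 ≤ N) {r : ℝ} (hr : 0 ≤ r) {f : Euc N → ℝ}
    (hf : Continuous f) :
    ∫ x in Metric.ball 0 r, f x
      = ∫ θ : Metric.sphere (0 : Euc N) 1, (∫ t in (0 : ℝ)..r, t ^ (N - 1) * f (t • (θ : Euc N)))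
        ∂(volume : Measure (Euc N)).toSphere := by
  have : Nontrivial (Euc N) := by
    have : Nonempty (Fin N) := ⟨⟨0, hN⟩⟩
    infer_instance
  set μ : Measure (Euc N) := volume
  set g : Euc N → ℝ := (Metric.ball 0 r).indicator f
  have hmp := μ.measurePreserving_homeomorphUnitSphereProd
  rw [finrank_euclideanSpace_fin] at hmp
  have hemb := (homeomorphUnitSphereProd (Euc N)).measurableEmbedding
  have hpol (p : ({0}ᶜ : Set (Euc N))) :
      ((homeomorphUnitSphereProd (Euc N) p).2 : ℝ) • ((homeomorphUnitSphereProd (Euc N) p).1 : Euc N)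
        = p := by
    have : ‖(p : Euc N)‖ ≠ 0 := norm_ne_zero_iff.2 p.2
    simp [smul_smul, this]
  have hgint : Integrable g μ := by
    rw [integrable_indicator_iff measurableSet_ball]
    exact (hf.continuousOn.integrableOn_compact (isCompact_closedBall 0 r)).mono_set
      Metric.ball_subset_closedBall
  set G : Metric.sphere (0 : Euc N) 1 × Set.Ioi (0 : ℝ) → ℝ := fun p => g ((p.2 : ℝ) • (p.1 : Euc N))
  have hGcomp : G ∘ homeomorphUnitSphereProd (Euc N) = fun p : ({0}ᶜ : Set (Euc N)) => g p := by
    ext p; simp only [G, Function.comp, hpol]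
  have hGint : Integrable G (μ.toSphere.prod (.volumeIoiPow (N - 1))) := by
    rw [← hmp.integrable_comp_emb hemb, hGcomp]
    have := (integrableOn_iff_comap_subtypeVal (μ := μ) (f := g)
      (measurableSet_singleton (0 : Euc N)).compl).1 hgint.integrableOn
    exact this
  calc ∫ x in Metric.ball 0 r, f x ∂μ = ∫ x, g x ∂μ := (integral_indicator measurableSet_ball).symm
    _ = ∫ x : ({(0)}ᶜ : Set (Euc N)), g x ∂(μ.comap (↑)) := by
      rw [integral_subtype_comap (measurableSet_singleton _).compl g, restrict_compl_singleton]
    _ = ∫ p, G p ∂μ.toSphere.prod (.volumeIoiPow (N - 1)) := by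
      rw [← hmp.integral_comp hemb]
      exact integral_congr_ae (.of_forall fun p => (congrFun hGcomp p).symm)
    _ = ∫ θ, ∫ t, G (θ, t) ∂(.volumeIoiPow (N - 1)) ∂μ.toSphere := integral_prod _ hGint
    _ = _ := by
      refine integral_congr_ae (.of_forall fun θ => ?_)
      have hθ : ‖(θ : Euc N)‖ = 1 := by simp
      simp only [Measure.volumeIoiPow, ENNReal.ofReal]
      rw [integral_withDensity_eq_integral_smul (measurable_subtype_coe.pow_const _).real_toNNReal,
        integral_subtype_comap measurableSet_Ioi
          fun t => Real.toNNReal (t ^ (N - 1)) • g (t • (θ : Euc N)),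
        intervalIntegral.integral_of_le hr, integral_Ioc_eq_integral_Ioo,
        ← integral_indicator measurableSet_Ioo, ← integral_indicator measurableSet_Ioi]
      refine integral_congr_ae (.of_forall fun t => ?_)
      simp only [Set.indicator, Set.mem_Ioi, Set.mem_Ioo, g, mem_ball_zero_iff]
      by_cases ht : 0 < t
      · simp [ht, norm_smul, hθ, abs_of_pos ht, NNReal.smul_def, max_eq_left (pow_nonneg ht.le (N - 1))]
      · simp [ht]

/-- The divergence theorem on a ball for the field `x ↦ ψ x • x`. -/
lemma setIntegral_ball_div_smul_id (hN : 1 ≤ N) {r : ℝ} (hr : 0 ≤ r) {ψ : Euc N → ℝ}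
    (hψ : ContDiff ℝ ∞ ψ) :
    ∫ x in Metric.ball 0 r, (N * ψ x + ∑ i, x i * partialDeriv i ψ x)
      = r ^ N * ∫ θ : Metric.sphere (0 : Euc N) 1, ψ (r • (θ : Euc N))
        ∂(volume : Measure (Euc N)).toSphere := by
  have hc (i : Fin N) := (ContDiff.partialDeriv hψ i).continuous
  have hc0 := hψ.continuous
  rw [setIntegral_ball_eq_integral_sphere hN hr (by fun_prop), ← integral_const_mul]
  refine integral_congr_ae (.of_forall fun θ => ?_)
  obtain ⟨n, rfl⟩ : ∃ n, N = n + 1 := ⟨N - 1, by omega⟩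
  -- Along each ray the integrand in polar coordinates is an exact derivative, so the fundamental
  -- theorem of calculus leaves only the value at `t = r`.
  have hd (t : ℝ) : HasDerivAt (fun t : ℝ => t ^ (n + 1) * ψ (t • (θ : Euc (n + 1))))
      (t ^ n * (((n + 1 : ℕ) : ℝ) * ψ (t • (θ : Euc (n + 1)))
        + ∑ i, (t • (θ : Euc (n + 1))) i * partialDeriv i ψ (t • (θ : Euc (n + 1))))) t := by
    have h1 : HasDerivAt (fun t : ℝ => t • (θ : Euc (n + 1))) (θ : Euc (n + 1)) t := by
      simpa using (hasDerivAt_id t).smul_const (θ : Euc (n + 1))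
    have h2 := ((hψ.differentiable (by simp)) (t • (θ : Euc (n + 1)))).hasFDerivAt.comp_hasDerivAt t h1
    convert! (hasDerivAt_pow (n + 1) t).mul h2 using 1
    rw [← fderiv_apply_eq_sum_partialDeriv, map_smul]
    simp
    ring
  simp only [Nat.add_sub_cancel]
  rw [intervalIntegral.integral_eq_sub_of_hasDerivAt (fun t _ => hd t)]
  · simp
  · apply Continuous.intervalIntegrable
    fun_prop

/-! ### Limits of integrals of products -/

/-- Continuity of the `L²` inner product. It carries every identity and inequality from test
functions to their Sobolev limits. -/
lemma tendsto_integral_mul_of_tendsto_eLpNorm {X : Type*} [MeasurableSpace X] {μ : Measure X}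
    {a b : X → ℝ} {an bn : ℕ → X → ℝ} (ha : MemLp a 2 μ) (hb : MemLp b 2 μ)
    (han : ∀ n, MemLp (an n) 2 μ) (hbn : ∀ n, MemLp (bn n) 2 μ)
    (hta : Tendsto (fun n => eLpNorm (fun x => an n x - a x) 2 μ) atTop (𝓝 0))
    (htb : Tendsto (fun n => eLpNorm (fun x => bn n x - b x) 2 μ) atTop (𝓝 0)) :
    Tendsto (fun n => ∫ x, an n x * bn n x ∂μ) atTop (𝓝 (∫ x, a x * b x ∂μ)) := by
  have key {f g : X → ℝ} (hf : MemLp f 2 μ) (hg : MemLp g 2 μ) :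
      inner ℝ (hf.toLp f : Lp ℝ 2 μ) (hg.toLp g : Lp ℝ 2 μ) = ∫ x, f x * g x ∂μ := by
    rw [L2.inner_def]
    refine integral_congr_ae ?_
    filter_upwards [hf.coeFn_toLp, hg.coeFn_toLp] with x hx hy
    rw [hx, hy]
    simp [mul_comm]
  have h1 := (Lp.tendsto_Lp_iff_tendsto_eLpNorm'' an han a ha).2 hta
  have h2 := (Lp.tendsto_Lp_iff_tendsto_eLpNorm'' bn hbn b hb).2 htb
  simpa only [key] using h1.inner (𝕜 := ℝ) h2

lemma tendsto_integral_mul_const_of_tendsto_eLpNorm {X : Type*} [MeasurableSpace X]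
    {μ : Measure X} {a b : X → ℝ} {bn : ℕ → X → ℝ} (ha : MemLp a 2 μ) (hb : MemLp b 2 μ)
    (hbn : ∀ n, MemLp (bn n) 2 μ)
    (htb : Tendsto (fun n => eLpNorm (fun x => bn n x - b x) 2 μ) atTop (𝓝 0)) :
    Tendsto (fun n => ∫ x, a x * bn n x ∂μ) atTop (𝓝 (∫ x, a x * b x ∂μ)) :=
  tendsto_integral_mul_of_tendsto_eLpNorm ha hb (fun _ => ha) hbn (by simp) htb

lemma _root_.MeasureTheory.MemLp.integrable_fun_mul {X : Type*} [MeasurableSpace X]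
    {μ : Measure X} {f g : X → ℝ} (hf : MemLp f 2 μ) (hg : MemLp g 2 μ) :
    Integrable (fun x => f x * g x) μ :=
  hf.integrable_mul hg

lemma _root_.MeasureTheory.Integrable.fun_sub {X : Type*} [MeasurableSpace X]
    {μ : Measure X} {f g : X → ℝ} (hf : Integrable f μ) (hg : Integrable g μ) :
    Integrable (fun x => f x - g x) μ :=
  hf.sub hg

/-! ### Elements of `H²` -/

lemma memLp_ball0 {u : Euc N → ℝ} (hu : Continuous u) (r : ℝ) :
    MemLp u 2 (volume.restrict (ball0 N r : Set (Euc N))) := by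
  have : IsFiniteMeasure (volume.restrict (ball0 N r : Set (Euc N))) :=
    ⟨by rw [Measure.restrict_apply_univ]; exact measure_ball_lt_top⟩
  obtain ⟨C, hC⟩ := (isCompact_closedBall (0 : Euc N) r).exists_bound_of_continuousOn
    hu.continuousOn
  refine MemLp.of_bound hu.aestronglyMeasurable C ?_
  filter_upwards [ae_restrict_mem (ball0 N r).isOpen.measurableSet] with x hx
  exact hC x (Metric.ball_subset_closedBall hx)

lemma integrable_ball0 {u : Euc N → ℝ} (hu : Continuous u) (r : ℝ) :
    Integrable u (volume.restrict (ball0 N r : Set (Euc N))) :=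
  (hu.continuousOn.integrableOn_compact (isCompact_closedBall 0 r)).mono_set
    Metric.ball_subset_closedBall

/-- The partial derivative of a test function. -/
def testPartial {U : Opens (Euc N)} (i : Fin N) (φ : 𝓓(U, ℝ)) : 𝓓(U, ℝ) where
  toFun := partialDeriv i φ
  contDiff' := ContDiff.partialDeriv φ.contDiff i
  hasCompactSupport' := HasCompactSupport.partialDeriv φ.hasCompactSupport i
  tsupport_subset' := (tsupport_partialDeriv_subset _ i).trans φ.tsupport_subset

namespace H2Function

/-- A smooth function as an element of `H²` of a ball. -/
def ofSmooth (u : Euc N → ℝ) (hu : ContDiff ℝ ∞ u) (r : ℝ) : H2Function (ball0 N r) where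
  toFun := u
  grad i := partialDeriv i u
  hess i j := partialDeriv j (partialDeriv i u)
  memLp_toFun := memLp_ball0 hu.continuous r
  memLp_grad i := memLp_ball0 (ContDiff.partialDeriv hu i).continuous r
  memLp_hess i j := memLp_ball0 (ContDiff.partialDeriv (ContDiff.partialDeriv hu i) j).continuous r
  isWeakPartial_grad i φ := setIntegral_mul_partialDeriv _ hu i φ
  isWeakPartial_hess i j φ := setIntegral_mul_partialDeriv _ (ContDiff.partialDeriv hu i) j φ

lemma _root_.TwoBall.memLp_testFunction {U : Opens (Euc N)} (φ : 𝓓(U, ℝ)) (μ : Measure (Euc N))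
    [IsFiniteMeasureOnCompacts μ] : MemLp φ 2 μ :=
  φ.continuous.memLp_of_hasCompactSupport φ.hasCompactSupport

lemma _root_.TwoBall.IsWeakPartial.sub {U : Opens (Euc N)} {i : Fin N} {v w v' w' : Euc N → ℝ}
    (h : IsWeakPartial U i v w) (h' : IsWeakPartial U i v' w')
    (hv : MemLp v 2 (volume.restrict (U : Set (Euc N))))
    (hw : MemLp w 2 (volume.restrict (U : Set (Euc N))))
    (hv' : MemLp v' 2 (volume.restrict (U : Set (Euc N))))
    (hw' : MemLp w' 2 (volume.restrict (U : Set (Euc N)))) :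
    IsWeakPartial U i (fun x => v x - v' x) (fun x => w x - w' x) := by
  intro φ
  have h1 := memLp_testFunction φ (volume.restrict (U : Set (Euc N)))
  have h2 : MemLp (partialDeriv i φ) 2 (volume.restrict (U : Set (Euc N))) :=
    memLp_testFunction (testPartial i φ) _
  simp only [sub_mul]
  rw [integral_sub (hv.integrable_fun_mul h2) (hv'.integrable_fun_mul h2),
    integral_sub (hw.integrable_fun_mul h1) (hw'.integrable_fun_mul h1), h φ, h' φ]
  ring

/-- The difference of two elements of `H²(U)`. -/
def sub {U : Opens (Euc N)} (u v : H2Function U) : H2Function U where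
  toFun x := u.toFun x - v.toFun x
  grad i x := u.grad i x - v.grad i x
  hess i j x := u.hess i j x - v.hess i j x
  memLp_toFun := u.memLp_toFun.sub v.memLp_toFun
  memLp_grad i := (u.memLp_grad i).sub (v.memLp_grad i)
  memLp_hess i j := (u.memLp_hess i j).sub (v.memLp_hess i j)
  isWeakPartial_grad i := (u.isWeakPartial_grad i).sub (v.isWeakPartial_grad i) u.memLp_toFun
    (u.memLp_grad i) v.memLp_toFun (v.memLp_grad i)
  isWeakPartial_hess i j := (u.isWeakPartial_hess i j).sub (v.isWeakPartial_hess i j)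
    (u.memLp_grad i) (u.memLp_hess i j) (v.memLp_grad i) (v.memLp_hess i j)

variable {U : Opens (Euc N)}

lemma memLp_laplacian (u : H2Function U) :
    MemLp u.laplacian 2 (volume.restrict (U : Set (Euc N))) :=
  memLp_finsetSum _ fun i _ => u.memLp_hess i i

lemma _root_.TwoBall.tendsto_eLpNorm_sub_zero {X : Type*} [MeasurableSpace X] {μ : Measure X}
    {a b : X → ℝ} {an bn : ℕ → X → ℝ} (ha : MemLp a 2 μ) (hb : MemLp b 2 μ)
    (han : ∀ n, MemLp (an n) 2 μ) (hbn : ∀ n, MemLp (bn n) 2 μ)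
    (hta : Tendsto (fun n => eLpNorm (fun x => an n x - a x) 2 μ) atTop (𝓝 0))
    (htb : Tendsto (fun n => eLpNorm (fun x => bn n x - b x) 2 μ) atTop (𝓝 0)) :
    Tendsto (fun n => eLpNorm (fun x => (an n x - bn n x) - (a x - b x)) 2 μ) atTop (𝓝 0) := by
  have h := hta.add htb
  rw [add_zero] at h
  refine tendsto_of_tendsto_of_tendsto_of_le_of_le tendsto_const_nhds h (fun _ => zero_le) fun n => ?_
  have : (fun x => (an n x - bn n x) - (a x - b x))
      = (fun x => an n x - a x) - fun x => bn n x - b x := by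
    ext x; simp only [Pi.sub_apply]; ring
  simp only [this]
  exact eLpNorm_sub_le ((han n).sub ha).aestronglyMeasurable ((hbn n).sub hb).aestronglyMeasurable
    (by norm_num)

lemma MemH10.sub {u v : H2Function U} (hu : u.MemH10) (hv : v.MemH10) : (u.sub v).MemH10 := by
  obtain ⟨φ, h1, h2⟩ := hu
  obtain ⟨ψ, h3, h4⟩ := hv
  refine ⟨fun n => φ n - ψ n, ?_, fun i => ?_⟩
  · exact tendsto_eLpNorm_sub_zero u.memLp_toFun v.memLp_toFun
      (fun n => memLp_testFunction (φ n) _) (fun n => memLp_testFunction (ψ n) _) h1 h3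
  · have hd (n : ℕ) (x : Euc N) : partialDeriv i (φ n - ψ n : 𝓓(U, ℝ)) x
        = partialDeriv i (φ n) x - partialDeriv i (ψ n) x := by
      have e : ((φ n - ψ n : 𝓓(U, ℝ)) : Euc N → ℝ) = (φ n : Euc N → ℝ) - (ψ n : Euc N → ℝ) := rfl
      simp only [partialDeriv]
      rw [e, fderiv_sub ((φ n).contDiff.differentiable (by simp) x)
        ((ψ n).contDiff.differentiable (by simp) x)]
      rfl
    simp only [hd]
    exact tendsto_eLpNorm_sub_zero (u.memLp_grad i) (v.memLp_grad i)
      (fun n => memLp_testFunction (testPartial i (φ n)) _)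
      (fun n => memLp_testFunction (testPartial i (ψ n)) _) (h2 i) (h4 i)

lemma MemH20.memH10 {u : H2Function U} (hu : u.MemH20) : u.MemH10 :=
  let ⟨φ, h1, h2, _⟩ := hu
  ⟨φ, h1, h2⟩

/-- Elements of `H¹₀` may be used as test functions for weak derivatives. -/
lemma MemH10.integral_mul_grad {u : H2Function U} (hu : u.MemH10) {i : Fin N} {v w : Euc N → ℝ}
    (h : IsWeakPartial U i v w) (hv : MemLp v 2 (volume.restrict (U : Set (Euc N))))
    (hw : MemLp w 2 (volume.restrict (U : Set (Euc N)))) :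
    ∫ x in U, v x * u.grad i x = - ∫ x in U, w x * u.toFun x := by
  obtain ⟨φ, h1, h2⟩ := hu
  have t1 := tendsto_integral_mul_const_of_tendsto_eLpNorm hw u.memLp_toFun
    (fun n => memLp_testFunction (φ n) _) h1
  have t2 := tendsto_integral_mul_const_of_tendsto_eLpNorm hv (u.memLp_grad i)
    (fun n => memLp_testFunction (testPartial i (φ n)) _) (h2 i)
  refine tendsto_nhds_unique t2 (t1.neg.congr fun n => ?_)
  exact (h (φ n)).symm

lemma MemH20.integral_mul_hess {u : H2Function U} (hu : u.MemH20) {i j : Fin N} {v w : Euc N → ℝ}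
    (h : IsWeakPartial U j v w) (hv : MemLp v 2 (volume.restrict (U : Set (Euc N))))
    (hw : MemLp w 2 (volume.restrict (U : Set (Euc N)))) :
    ∫ x in U, v x * u.hess i j x = - ∫ x in U, w x * u.grad i x := by
  obtain ⟨φ, -, h1, h2⟩ := hu
  have t1 := tendsto_integral_mul_const_of_tendsto_eLpNorm hw (u.memLp_grad i)
    (fun n => memLp_testFunction (testPartial i (φ n)) _) (h1 i)
  have t2 := tendsto_integral_mul_const_of_tendsto_eLpNorm hv (u.memLp_hess i j)
    (fun n => memLp_testFunction (testPartial j (testPartial i (φ n))) _) (h2 i j)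
  refine tendsto_nhds_unique t2 (t1.neg.congr fun n => ?_)
  exact (h (testPartial i (φ n))).symm

/-- Green's formula has no boundary term on test functions, and both sides pass to the limit in
`H²`. -/
lemma MemH20.hasNormalDeriv {r : ℝ} {u : H2Function (ball0 N r)} (hu : u.MemH20) :
    HasNormalDeriv u 0 := by
  intro φ hφ
  have h1 := memLp_ball0 hφ.continuous r
  have h2 (i : Fin N) := memLp_ball0 (ContDiff.partialDeriv hφ i).continuous r
  simp only [laplacian, Finset.mul_sum, ← Finset.sum_add_distrib]
  rw [integral_finsetSum _ fun i _ =>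
    (h1.integrable_fun_mul (u.memLp_hess i i)).fun_add ((h2 i).integrable_fun_mul (u.memLp_grad i))]
  simp only [sphereIntegral, zero_mul, integral_zero, mul_zero]
  refine Finset.sum_eq_zero fun i _ => ?_
  rw [integral_add (h1.integrable_fun_mul (u.memLp_hess i i)) ((h2 i).integrable_fun_mul (u.memLp_grad i)),
    hu.integral_mul_hess (setIntegral_mul_partialDeriv _ hφ i) h1 (h2 i)]
  ring

/-- Integrating `xᵢ φ` by parts against `∂ᵢφ` gives `∫ φ² = -2 ∫ xᵢ φ ∂ᵢφ`; Young's inequality with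
`|xᵢ| ≤ r` absorbs half of the left side. -/
lemma _root_.TwoBall.poincare_testFunction {r : ℝ} (i : Fin N) (φ : 𝓓(ball0 N r, ℝ)) :
    ∫ x in ball0 N r, φ x * φ x
      ≤ 4 * r ^ 2 * ∫ x in ball0 N r, partialDeriv i φ x * partialDeriv i φ x := by
  have hφ : ContDiff ℝ ∞ φ := φ.contDiff
  have hd := ContDiff.partialDeriv hφ i
  have hx : Continuous fun x : Euc N => x i := (contDiff_coord i).continuous
  have hφc := hφ.continuous
  have hdc := hd.continuous
  have h := setIntegral_mul_partialDeriv (ball0 N r) (v := fun x => x i * φ x)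
    ((contDiff_coord i).mul hφ) i φ
  have e (x : Euc N) : partialDeriv i (fun x => x i * φ x) x * φ x
      = φ x * φ x + x i * φ x * partialDeriv i φ x := by
    have := partialDeriv_mul ((contDiff_coord i).differentiable (by simp) x)
      (hφ.differentiable (by simp) x) i
    rw [partialDeriv_coord, if_pos rfl] at this
    rw [this]
    ring
  have i1 : Integrable (fun x => φ x * φ x) (volume.restrict (ball0 N r : Set (Euc N))) :=
    integrable_ball0 (by fun_prop) r
  have i2 : Integrable (fun x => x i * φ x * partialDeriv i φ x)
      (volume.restrict (ball0 N r : Set (Euc N))) := integrable_ball0 (by fun_prop) r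
  have i3 : Integrable (fun x => partialDeriv i φ x * partialDeriv i φ x)
      (volume.restrict (ball0 N r : Set (Euc N))) := integrable_ball0 (by fun_prop) r
  rw [integral_congr_ae (.of_forall e), integral_add i1 i2] at h
  have hle : ∫ x in ball0 N r, (-2) * (x i * φ x * partialDeriv i φ x)
      ≤ ∫ x in ball0 N r, (1 / 2 * (φ x * φ x)
        + 2 * r ^ 2 * (partialDeriv i φ x * partialDeriv i φ x)) := by
    refine setIntegral_mono_on (i2.const_mul _) ((i1.const_mul _).add (i3.const_mul _))
      (ball0 N r).isOpen.measurableSet fun x hx => ?_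
    have hx1 : ‖x‖ < r := by simpa [ball0] using hx
    have hx2 : |x i| ≤ r := (PiLp.norm_apply_le x i).trans hx1.le
    have hx3 : x i ^ 2 ≤ r ^ 2 := sq_le_sq' (abs_le.1 hx2).1 (abs_le.1 hx2).2
    nlinarith [sq_nonneg (φ x + 2 * x i * partialDeriv i φ x),
      mul_le_mul_of_nonneg_right hx3 (sq_nonneg (partialDeriv i φ x))]
  rw [integral_const_mul, integral_add (i1.const_mul _) (i3.const_mul _), integral_const_mul,
    integral_const_mul] at hle
  linarith

/-- Poincaré's inequality on a ball. -/
lemma MemH10.poincare {r : ℝ} {u : H2Function (ball0 N r)} (hu : u.MemH10) (i : Fin N) :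
    ∫ x in ball0 N r, u.toFun x * u.toFun x
      ≤ 4 * r ^ 2 * ∫ x in ball0 N r, u.grad i x * u.grad i x := by
  obtain ⟨φ, h1, h2⟩ := hu
  have t1 := tendsto_integral_mul_of_tendsto_eLpNorm u.memLp_toFun u.memLp_toFun
    (fun n => memLp_testFunction (φ n) _) (fun n => memLp_testFunction (φ n) _) h1 h1
  have t2 := tendsto_integral_mul_of_tendsto_eLpNorm (u.memLp_grad i) (u.memLp_grad i)
    (fun n => memLp_testFunction (testPartial i (φ n)) _)
    (fun n => memLp_testFunction (testPartial i (φ n)) _) (h2 i) (h2 i)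
  exact le_of_tendsto_of_tendsto' t1 (t2.const_mul _) fun n => poincare_testFunction i (φ n)

/-- Under small compression the quadratic part of the plate energy is nonnegative. -/
lemma MemH10.quadratic_nonneg (hN : 1 ≤ N) {r σ : ℝ} (hr : 0 < r) (hσ : 4 * r ^ 2 * σ ^ 2 ≤ 1)
    {u : H2Function (ball0 N r)} (hu : u.MemH10) :
    0 ≤ (∫ x in ball0 N r, u.laplacian x ^ 2)
      - σ ^ 2 * ∫ x in ball0 N r, ∑ i, u.grad i x ^ 2 := by
  set L := ∫ x in ball0 N r, u.laplacian x ^ 2 with hL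
  set D := ∫ x in ball0 N r, ∑ i, u.grad i x ^ 2 with hD
  have hgi (i : Fin N) : Integrable (fun x => u.grad i x ^ 2)
    (volume.restrict (ball0 N r : Set (Euc N))) := (u.memLp_grad i).integrable_sq
  have hL0 : 0 ≤ L := integral_nonneg fun x => sq_nonneg _
  have h1 : D = - ∫ x in ball0 N r, u.laplacian x * u.toFun x := by
    simp only [hD, laplacian, Finset.sum_mul]
    rw [integral_finsetSum _ fun i _ => hgi i,
      integral_finsetSum _ fun i _ => (u.memLp_hess i i).integrable_fun_mul u.memLp_toFun,
      ← Finset.sum_neg_distrib]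
    refine Finset.sum_congr rfl fun i _ => ?_
    rw [← hu.integral_mul_grad (u.isWeakPartial_hess i i) (u.memLp_grad i) (u.memLp_hess i i)]
    simp only [sq]
  have h2 : ∫ x in ball0 N r, u.toFun x ^ 2 ≤ 4 * r ^ 2 * D := by
    have hp := hu.poincare ⟨0, hN⟩
    simp only [← sq] at hp
    refine hp.trans ?_
    gcongr
    rw [hD]
    refine integral_mono (hgi _) (integrable_finsetSum _ fun i _ => hgi i) fun x => ?_
    exact Finset.single_le_sum (f := fun i => u.grad i x ^ 2) (fun i _ => sq_nonneg _)
      (Finset.mem_univ _)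
  -- Young's weights are chosen so that Poincaré turns the `u²` term into exactly `D / 2`, which is
  -- then absorbed to give `D ≤ 4 r² L`.
  have h3 : - ∫ x in ball0 N r, u.laplacian x * u.toFun x
      ≤ 2 * r ^ 2 * L + 1 / (8 * r ^ 2) * ∫ x in ball0 N r, u.toFun x ^ 2 := by
    rw [hL, ← integral_const_mul, ← integral_const_mul, ← integral_neg, ← integral_add
      (u.memLp_laplacian.integrable_sq.const_mul _) (u.memLp_toFun.integrable_sq.const_mul _)]
    refine integral_mono (u.memLp_laplacian.integrable_fun_mul u.memLp_toFun).neg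
      ((u.memLp_laplacian.integrable_sq.const_mul _).add
        (u.memLp_toFun.integrable_sq.const_mul _)) fun x => ?_
    have : 2 * r ^ 2 * u.laplacian x ^ 2 + 1 / (8 * r ^ 2) * u.toFun x ^ 2
        - -(u.laplacian x * u.toFun x)
        = 1 / (8 * r ^ 2) * (4 * r ^ 2 * u.laplacian x + u.toFun x) ^ 2 := by
      field_simp; ring
    have h0 : 0 ≤ 1 / (8 * r ^ 2) * (4 * r ^ 2 * u.laplacian x + u.toFun x) ^ 2 := by positivity
    linarith
  have h4 : 1 / (8 * r ^ 2) * ∫ x in ball0 N r, u.toFun x ^ 2 ≤ D / 2 := by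
    calc _ ≤ 1 / (8 * r ^ 2) * (4 * r ^ 2 * D) := by gcongr
      _ = D / 2 := by field_simp; ring
  have h5 : D ≤ 4 * r ^ 2 * L := by linarith
  nlinarith [mul_le_mul_of_nonneg_left h5 (sq_nonneg σ), mul_le_mul_of_nonneg_right hσ hL0]

/-! ### Solutions of the Euler–Lagrange equation minimize the energy -/

/-- The surface area of the unit sphere. -/
def _root_.TwoBall.sphereArea (N : ℕ) : ℝ := (volume : Measure (Euc N)).toSphere.real Set.univ

lemma _root_.TwoBall.sphereIntegral_of_const {r ℓ : ℝ} (hr : 0 ≤ r) {φ : Euc N → ℝ}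
    (h : ∀ x, ‖x‖ = r → φ x = ℓ) : sphereIntegral N r φ = r ^ (N - 1) * ℓ * sphereArea N := by
  have e (θ : Metric.sphere (0 : Euc N) 1) : φ (r • (θ : Euc N)) = ℓ :=
    h _ (by simp [norm_smul, abs_of_nonneg hr])
  simp only [sphereIntegral, e, integral_const, sphereArea, smul_eq_mul]
  ring

lemma ofSmooth_laplacian {h : Euc N → ℝ} (hh : ContDiff ℝ ∞ h) (r : ℝ) :
    (ofSmooth h hh r).laplacian = lap h := rfl

/-- The weak form of the Euler–Lagrange equation, with its boundary term. -/
lemma firstVariation {r σ α ℓ p : ℝ} (hr : 0 ≤ r) {h : Euc N → ℝ} (hh : ContDiff ℝ ∞ h)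
    (hpde : ∀ x, lap (lap h) x + σ ^ 2 * lap h x = α) (hℓ : ∀ x, ‖x‖ = r → lap h x = ℓ)
    {v : H2Function (ball0 N r)} (hv : v.MemH10) (hp : HasNormalDeriv v p) :
    (∫ x in ball0 N r, lap h x * v.laplacian x)
      - σ ^ 2 * (∫ x in ball0 N r, ∑ i, partialDeriv i h x * v.grad i x)
      - α * (∫ x in ball0 N r, v.toFun x) = r ^ (N - 1) * p * ℓ * sphereArea N := by
  have key (w : Euc N → ℝ) (hw : ContDiff ℝ ∞ w) :
      ∫ x in ball0 N r, ∑ i, partialDeriv i w x * v.grad i x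
        = - ∫ x in ball0 N r, lap w x * v.toFun x := by
    have hi (i : Fin N) := memLp_ball0 (ContDiff.partialDeriv hw i).continuous r
    have hii (i : Fin N) :=
      memLp_ball0 (ContDiff.partialDeriv (ContDiff.partialDeriv hw i) i).continuous r
    simp only [lap, Finset.sum_mul]
    rw [integral_finsetSum _ fun i _ => (hi i).integrable_fun_mul (v.memLp_grad i),
      integral_finsetSum _ fun i _ => (hii i).integrable_fun_mul v.memLp_toFun,
      ← Finset.sum_neg_distrib]
    exact Finset.sum_congr rfl fun i _ => hv.integral_mul_grad
      (setIntegral_mul_partialDeriv _ (ContDiff.partialDeriv hw i) i) (hi i) (hii i)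
  have hl := ContDiff.lap hh
  have hll := ContDiff.lap hl
  -- Green's formula is tested with `Δh`. Since `Δh` is the constant `ℓ` on the sphere, only the
  -- number `p` survives from the trace of `v`.
  have hg := hp (lap h) hl
  rw [sphereIntegral_of_const (ℓ := p * ℓ) hr fun x hx => by rw [hℓ x hx],
    integral_add ((memLp_ball0 hl.continuous r).integrable_fun_mul v.memLp_laplacian)
      (integrable_finsetSum _ fun i _ =>
        (memLp_ball0 (ContDiff.partialDeriv hl i).continuous r).integrable_fun_mul (v.memLp_grad i)),
    key _ hl] at hg
  have h1 : α * (∫ x in ball0 N r, v.toFun x) = (∫ x in ball0 N r, lap (lap h) x * v.toFun x)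
      + σ ^ 2 * ∫ x in ball0 N r, lap h x * v.toFun x := by
    rw [← integral_const_mul, ← integral_const_mul, ← integral_add
      ((memLp_ball0 hll.continuous r).integrable_fun_mul v.memLp_toFun)
      (((memLp_ball0 hl.continuous r).integrable_fun_mul v.memLp_toFun).const_mul _)]
    refine integral_congr_ae (.of_forall fun x => ?_)
    simp only
    rw [← hpde x]
    ring
  rw [key _ hh, h1]
  linarith

/-- The weak equation tested with `h` itself eliminates the quadratic terms. -/
lemma plateEnergy_ofSmooth {r σ α ℓ p : ℝ} (hr : 0 ≤ r) {h : Euc N → ℝ} (hh : ContDiff ℝ ∞ h)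
    (hpde : ∀ x, lap (lap h) x + σ ^ 2 * lap h x = α) (hℓ : ∀ x, ‖x‖ = r → lap h x = ℓ)
    (hv : (ofSmooth h hh r).MemH10) (hp : HasNormalDeriv (ofSmooth h hh r) p) :
    (ofSmooth h hh r).plateEnergy σ α
      = - (α / 2) * (∫ x in ball0 N r, h x) + r ^ (N - 1) * (p / 2) * ℓ * sphereArea N := by
  have h1 := firstVariation hr hh hpde hℓ hv hp
  rw [plateEnergy]
  simp only [ofSmooth_laplacian, sq (lap h _)] at h1 ⊢
  simp only [ofSmooth, ← sq (partialDeriv _ h _)] at h1 ⊢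
  linarith

/-- Expand the nonnegative quadratic form at `v - h` and remove the cross terms by the first
variation. The bound is affine in the normal derivative `p`, with slope proportional to `ℓ`; on two
balls with opposite `ℓ` these terms cancel under the flux constraint. -/
lemma le_plateEnergy (hN : 1 ≤ N) {r σ α ℓ p q : ℝ} (hr : 0 < r) (hσ : 4 * r ^ 2 * σ ^ 2 ≤ 1)
    {h : Euc N → ℝ} (hh : ContDiff ℝ ∞ h)
    (hpde : ∀ x, lap (lap h) x + σ ^ 2 * lap h x = α) (hℓ : ∀ x, ‖x‖ = r → lap h x = ℓ)
    (hu : (ofSmooth h hh r).MemH10) (hq : HasNormalDeriv (ofSmooth h hh r) q)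
    {v : H2Function (ball0 N r)} (hv : v.MemH10) (hp : HasNormalDeriv v p) :
    - (α / 2) * (∫ x in ball0 N r, h x) + r ^ (N - 1) * (p - q / 2) * ℓ * sphereArea N
      ≤ v.plateEnergy σ α := by
  have h0 := plateEnergy_ofSmooth hr.le hh hpde hℓ hu hq
  have h1 := firstVariation hr.le hh hpde hℓ hv hp
  have hQ := (hv.sub hu).quadratic_nonneg hN hr hσ
  have hl := memLp_ball0 (ContDiff.lap hh).continuous r
  have hd (i : Fin N) := memLp_ball0 (ContDiff.partialDeriv hh i).continuous r
  have e1 : ∫ x in ball0 N r, (v.sub (ofSmooth h hh r)).laplacian x ^ 2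
      = (∫ x in ball0 N r, v.laplacian x ^ 2) - 2 * (∫ x in ball0 N r, lap h x * v.laplacian x)
        + ∫ x in ball0 N r, lap h x ^ 2 := by
    rw [← integral_const_mul, ← integral_sub v.memLp_laplacian.integrable_sq
      ((hl.integrable_fun_mul v.memLp_laplacian).const_mul _), ← integral_add
      (v.memLp_laplacian.integrable_sq.fun_sub ((hl.integrable_fun_mul v.memLp_laplacian).const_mul _))
      hl.integrable_sq]
    refine integral_congr_ae (.of_forall fun x => ?_)
    have : (v.sub (ofSmooth h hh r)).laplacian x = v.laplacian x - lap h x := by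
      simp [laplacian, sub, ofSmooth, lap]
    simp only [this]
    ring
  have e2 : ∫ x in ball0 N r, ∑ i, (v.sub (ofSmooth h hh r)).grad i x ^ 2
      = (∫ x in ball0 N r, ∑ i, v.grad i x ^ 2)
        - 2 * (∫ x in ball0 N r, ∑ i, partialDeriv i h x * v.grad i x)
        + ∫ x in ball0 N r, ∑ i, partialDeriv i h x ^ 2 := by
    have j1 : Integrable (fun x => ∑ i, v.grad i x ^ 2)
        (volume.restrict (ball0 N r : Set (Euc N))) :=
      integrable_finsetSum _ fun i _ => (v.memLp_grad i).integrable_sq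
    have j2 : Integrable (fun x => ∑ i, partialDeriv i h x * v.grad i x)
        (volume.restrict (ball0 N r : Set (Euc N))) :=
      integrable_finsetSum _ fun i _ => (hd i).integrable_fun_mul (v.memLp_grad i)
    have j3 : Integrable (fun x => ∑ i, partialDeriv i h x ^ 2)
        (volume.restrict (ball0 N r : Set (Euc N))) :=
      integrable_finsetSum _ fun i _ => (hd i).integrable_sq
    rw [← integral_const_mul, ← integral_sub j1 (j2.const_mul _),
      ← integral_add (j1.fun_sub (j2.const_mul _)) j3]
    refine integral_congr_ae (.of_forall fun x => ?_)
    simp only [Finset.mul_sum, ← Finset.sum_sub_distrib, ← Finset.sum_add_distrib]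
    refine Finset.sum_congr rfl fun i _ => ?_
    simp only [sub, ofSmooth]
    ring
  rw [e1, e2] at hQ
  rw [plateEnergy] at h0 ⊢
  simp only [ofSmooth_laplacian] at h0
  simp only [ofSmooth] at h0
  linarith

end H2Function

/-! ### Radial functions -/

/-- Dominated convergence. Cutoff derivatives therefore need only uniform bounds, not decay. -/
lemma tendsto_eLpNorm_ball0_of_bounded {r C : ℝ} {g : Euc N → ℝ} {gn : ℕ → Euc N → ℝ}
    (hg : Continuous g) (hgn : ∀ n, Continuous (gn n))
    (hbound : ∀ n, ∀ x ∈ Metric.ball (0 : Euc N) r, |gn n x| ≤ C)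
    (hlim : ∀ x ∈ Metric.ball (0 : Euc N) r, ∀ᶠ n in atTop, gn n x = g x) :
    Tendsto (fun n => eLpNorm (fun x => gn n x - g x) 2
      (volume.restrict (ball0 N r : Set (Euc N)))) atTop (𝓝 0) := by
  have hms : ∀ᵐ x ∂(volume.restrict (ball0 N r : Set (Euc N))), x ∈ Metric.ball (0 : Euc N) r :=
    ae_restrict_mem (ball0 N r).isOpen.measurableSet
  have key : Tendsto (fun n => ∫ x in ball0 N r, ‖gn n x - g x‖ ^ (2 : ENNReal).toReal) atTop
      (𝓝 (∫ _ : Euc N in ball0 N r, (0 : ℝ))) := by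
    refine tendsto_integral_of_dominated_convergence (fun x => (C + |g x|) ^ 2) (fun n => ?_)
      (integrable_ball0 (by fun_prop) r) (fun n => ?_) ?_
    · have := hgn n
      simp only [ENNReal.toReal_ofNat, Real.rpow_ofNat]
      exact Continuous.aestronglyMeasurable (by fun_prop)
    · filter_upwards [hms] with x hx
      simp only [ENNReal.toReal_ofNat, Real.rpow_ofNat, norm_pow, norm_norm]
      gcongr
      exact (abs_sub _ _).trans (by gcongr; exact hbound n x hx)
    · filter_upwards [hms] with x hx
      refine tendsto_const_nhds.congr' ?_
      filter_upwards [hlim x hx] with n hn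
      simp [hn]
  rw [integral_zero] at key
  have h2 := (key.rpow_const (p := (2 : ENNReal).toReal⁻¹) (Or.inr (by simp)))
  have h3 := ENNReal.tendsto_ofReal h2
  rw [Real.zero_rpow (by simp), ENNReal.ofReal_zero] at h3
  refine h3.congr fun n => ?_
  have e : (fun x => gn n x - g x) = gn n - g := rfl
  rw [e, ((memLp_ball0 (hgn n) r).sub (memLp_ball0 hg r)).eLpNorm_eq_integral_rpow_norm
    (by simp) (by simp)]
  rfl

/-- The radial function `x ↦ F (‖x‖ ^ 2)` as an element of `H²(B_r)`. -/
def radial (N : ℕ) (F : ℝ → ℝ) (hF : ContDiff ℝ ∞ F) (r : ℝ) : H2Function (ball0 N r) :=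
  H2Function.ofSmooth (fun x => F (‖x‖ ^ 2)) (contDiff_comp_sq_norm hF) r

/-- The gradient is `2 F'(‖x‖²) x`, so `φ ∇u` is a multiple of the identity field and the divergence
theorem for such fields applies. -/
lemma hasNormalDeriv_radial (hN : 1 ≤ N) {F : ℝ → ℝ} (hF : ContDiff ℝ ∞ F) {r : ℝ} (hr : 0 ≤ r) :
    HasNormalDeriv (radial N F hF r) (2 * r * deriv F (r ^ 2)) := by
  intro φ hφ
  have hF' : ContDiff ℝ ∞ fun t => 2 * deriv F t :=
    contDiff_const.mul (contDiff_deriv_of_contDiff hF)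
  have hu := contDiff_comp_sq_norm (N := N) hF'
  have h := setIntegral_ball_div_smul_id hN hr (hφ.mul hu)
  rw [sphereIntegral]
  trans r ^ N * ∫ θ : Metric.sphere (0 : Euc N) 1, φ (r • (θ : Euc N)) * (2 * deriv F (r ^ 2))
        ∂(volume : Measure (Euc N)).toSphere
  · have e (θ : Metric.sphere (0 : Euc N) 1) : ‖r • (θ : Euc N)‖ ^ 2 = r ^ 2 := by
      simp [norm_smul]
    simp only [e] at h
    rw [← h]
    refine integral_congr_ae (.of_forall fun x => ?_)
    have hd (i : Fin N) := partialDeriv_mul (hφ.differentiable (by simp) x)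
      (hu.differentiable (by simp) x) i
    simp only [partialDeriv_comp_sq_norm hF'] at hd
    simp only [hd, radial, H2Function.ofSmooth_laplacian, lap_comp_sq_norm hF]
    simp only [H2Function.ofSmooth, partialDeriv_comp_sq_norm hF]
    rw [deriv_const_mul _ ((contDiff_deriv_of_contDiff hF).differentiable (by simp) _)]
    have e1 (i : Fin N) : x i * (partialDeriv i φ x * (2 * deriv F (‖x‖ ^ 2))
        + φ x * (2 * x i * (2 * deriv (deriv F) (‖x‖ ^ 2))))
        = partialDeriv i φ x * (2 * x i * deriv F (‖x‖ ^ 2))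
          + (x i * x i) * (4 * φ x * deriv (deriv F) (‖x‖ ^ 2)) := by ring
    simp only [e1, Finset.sum_add_distrib]
    rw [← Finset.sum_mul, sum_sq_coord]
    ring
  · obtain ⟨n, rfl⟩ : ∃ n, N = n + 1 := ⟨N - 1, by omega⟩
    rw [Nat.add_sub_cancel, integral_mul_const, integral_const_mul]
    ring

lemma exists_abs_le_mul_sub {F : ℝ → ℝ} (hF : ContDiff ℝ ∞ F) {R : ℝ} (h0 : F R = 0) :
    ∃ K, 0 ≤ K ∧ ∀ t ∈ Set.Icc 0 R, |F t| ≤ K * (R - t) := by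
  obtain ⟨C, hC⟩ := (isCompact_Icc (a := 0) (b := R)).exists_bound_of_continuousOn
    (contDiff_deriv_of_contDiff hF).continuous.continuousOn
  refine ⟨max C 0, le_max_right _ _, fun t ht => ?_⟩
  have := (convex_Icc 0 R).norm_image_sub_le_of_norm_deriv_le
    (fun x _ => hF.differentiable (by simp) x) (fun x hx => (hC x hx).trans (le_max_left C 0))
    (Set.right_mem_Icc.2 (ht.1.trans ht.2)) ht
  rw [h0, sub_zero, Real.norm_eq_abs, Real.norm_eq_abs, abs_sub_comm, abs_of_nonneg (sub_nonneg.2 ht.2)]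
    at this
  exact this

lemma exists_abs_le_mul_sub_sq {F : ℝ → ℝ} (hF : ContDiff ℝ ∞ F) {R : ℝ} (h0 : F R = 0)
    (h1 : deriv F R = 0) : ∃ K, 0 ≤ K ∧ ∀ t ∈ Set.Icc 0 R, |F t| ≤ K * (R - t) ^ 2 := by
  obtain ⟨K, hK, hb⟩ := exists_abs_le_mul_sub (contDiff_deriv_of_contDiff hF) h1
  refine ⟨K, hK, fun t ht => ?_⟩
  have := (convex_Icc t R).norm_image_sub_le_of_norm_deriv_le (f := F) (C := K * (R - t))
    (fun x _ => hF.differentiable (by simp) x)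
    (fun x hx => (hb x ⟨ht.1.trans hx.1, hx.2⟩).trans (by gcongr; exact hx.1))
    (Set.right_mem_Icc.2 ht.2) (Set.left_mem_Icc.2 ht.2)
  rw [h0, sub_zero, Real.norm_eq_abs, Real.norm_eq_abs, abs_sub_comm, abs_of_nonneg (sub_nonneg.2 ht.2)]
    at this
  linarith [this]

/-- A smooth cutoff in the squared radius, equal to `1` at distance `≥ 2 / (n + 1)` below `R`
and to `0` at distance `≤ 1 / (n + 1)`. -/
def cutoff (R : ℝ) (n : ℕ) (t : ℝ) : ℝ := Real.smoothTransition ((n + 1) * (R - t) - 1)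

lemma contDiff_cutoff (R : ℝ) (n : ℕ) : ContDiff ℝ ∞ (cutoff R n) :=
  Real.smoothTransition.contDiff.comp
    ((contDiff_const.mul (contDiff_const.sub contDiff_id)).sub contDiff_const)

lemma deriv_comp_cutoff_arg {g : ℝ → ℝ} (hg : ContDiff ℝ ∞ g) (R : ℝ) (n : ℕ) (t : ℝ) :
    deriv (fun t => g ((n + 1) * (R - t) - 1)) t
      = -(n + 1) * deriv g ((n + 1) * (R - t) - 1) := by
  have h1 : HasDerivAt (fun t : ℝ => ((n : ℝ) + 1) * (R - t) - 1) (-((n : ℝ) + 1)) t := by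
    convert! (((hasDerivAt_id t).const_sub R).const_mul ((n : ℝ) + 1)).sub_const 1 using 1
    ring
  have h2 := ((hg.differentiable (by simp) ((n + 1) * (R - t) - 1)).hasDerivAt).comp t h1
  rw [show (fun t => g ((n + 1) * (R - t) - 1)) = g ∘ fun t : ℝ => ((n : ℝ) + 1) * (R - t) - 1
    from rfl, h2.deriv]
  ring

lemma deriv_cutoff (R : ℝ) (n : ℕ) (t : ℝ) : deriv (cutoff R n) t
    = -(n + 1) * deriv Real.smoothTransition ((n + 1) * (R - t) - 1) :=
  deriv_comp_cutoff_arg Real.smoothTransition.contDiff R n t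

lemma deriv_deriv_cutoff (R : ℝ) (n : ℕ) (t : ℝ) : deriv (deriv (cutoff R n)) t
    = (n + 1) ^ 2 * deriv (deriv Real.smoothTransition) ((n + 1) * (R - t) - 1) := by
  have hs := contDiff_deriv_of_contDiff
    (Real.smoothTransition.contDiff : ContDiff ℝ ∞ Real.smoothTransition)
  rw [funext (deriv_cutoff R n), deriv_const_mul _, deriv_comp_cutoff_arg hs]
  · ring
  · exact (hs.comp ((contDiff_const.mul (contDiff_const.sub contDiff_id)).sub
      contDiff_const)).differentiable (by simp) t

lemma deriv_smoothTransition_hasCompactSupport :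
    HasCompactSupport (deriv Real.smoothTransition) := by
  refine HasCompactSupport.intro (isCompact_Icc (a := 0) (b := 1)) fun x hx => ?_
  rw [Set.mem_Icc, not_and_or, not_le, not_le] at hx
  rcases hx with hx | hx
  · have : Real.smoothTransition =ᶠ[𝓝 x] fun _ => 0 := by
      filter_upwards [Iio_mem_nhds hx] with y hy
      exact Real.smoothTransition.zero_of_nonpos (le_of_lt hy)
    rw [this.deriv_eq, deriv_const]
  · have : Real.smoothTransition =ᶠ[𝓝 x] fun _ => 1 := by
      filter_upwards [Ioi_mem_nhds hx] with y hy
      exact Real.smoothTransition.one_of_one_le (le_of_lt hy)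
    rw [this.deriv_eq, deriv_const]

lemma exists_abs_mul_deriv_smoothTransition_le :
    ∃ C, 0 ≤ C ∧ ∀ w : ℝ, |w * deriv Real.smoothTransition (w - 1)| ≤ C := by
  have hc : Continuous fun y => (y + 1) * deriv Real.smoothTransition y := by
    have := (contDiff_deriv_of_contDiff
      (Real.smoothTransition.contDiff : ContDiff ℝ ∞ Real.smoothTransition)).continuous
    fun_prop
  obtain ⟨C, hC⟩ := hc.bounded_above_of_compact_support
    (deriv_smoothTransition_hasCompactSupport.mul_left (f := fun y => y + 1))
  refine ⟨C, (norm_nonneg _).trans (hC 0), fun w => ?_⟩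
  simpa using hC (w - 1)

lemma exists_abs_mul_deriv_deriv_smoothTransition_le :
    ∃ C, 0 ≤ C ∧ ∀ w : ℝ, |w ^ 2 * deriv (deriv Real.smoothTransition) (w - 1)| ≤ C := by
  have hc : Continuous fun y => (y + 1) ^ 2 * deriv (deriv Real.smoothTransition) y := by
    have := (contDiff_deriv_of_contDiff (contDiff_deriv_of_contDiff
      (Real.smoothTransition.contDiff : ContDiff ℝ ∞ Real.smoothTransition))).continuous
    fun_prop
  obtain ⟨C, hC⟩ := hc.bounded_above_of_compact_support
    (deriv_smoothTransition_hasCompactSupport.deriv.mul_left (f := fun y => (y + 1) ^ 2))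
  refine ⟨C, (norm_nonneg _).trans (hC 0), fun w => ?_⟩
  simpa using hC (w - 1)

/-- In the variable `w = (n + 1)(R - t)` the product is `-w χ'(w - 1)`, with `χ` the smooth
transition. It no longer depends on `n`, and it is continuous with compact support in `w`. -/
lemma exists_abs_deriv_cutoff_mul_le :
    ∃ C, 0 ≤ C ∧ ∀ (R : ℝ) (n : ℕ) (t : ℝ), |deriv (cutoff R n) t * (R - t)| ≤ C := by
  obtain ⟨C, hC0, hC⟩ := exists_abs_mul_deriv_smoothTransition_le
  refine ⟨C, hC0, fun R n t => ?_⟩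
  have := hC ((n + 1) * (R - t))
  rw [deriv_cutoff, ← abs_neg]
  convert! this using 2
  ring

lemma exists_abs_deriv_deriv_cutoff_mul_le :
    ∃ C, 0 ≤ C ∧ ∀ (R : ℝ) (n : ℕ) (t : ℝ), |deriv (deriv (cutoff R n)) t * (R - t) ^ 2| ≤ C := by
  obtain ⟨C, hC0, hC⟩ := exists_abs_mul_deriv_deriv_smoothTransition_le
  refine ⟨C, hC0, fun R n t => ?_⟩
  have := hC ((n + 1) * (R - t))
  rw [deriv_deriv_cutoff]
  convert! this using 2
  ring

lemma abs_cutoff_le (R : ℝ) (n : ℕ) (t : ℝ) : |cutoff R n t| ≤ 1 := by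
  rw [cutoff, abs_of_nonneg (Real.smoothTransition.nonneg _)]
  exact Real.smoothTransition.le_one _

/-- Equality on a whole neighbourhood of `t` is needed so that derivatives of the truncations agree
as well. Below the midpoint of `t` and `R` the distance to `R` exceeds `(R - t) / 2`, which is why
`n₀` has this size. -/
lemma eventually_cutoff_eq_one {R t : ℝ} (ht : t < R) :
    ∀ᶠ n in atTop, ∀ᶠ s in 𝓝 t, cutoff R n s = 1 := by
  obtain ⟨n₀, hn₀⟩ := exists_nat_gt (2 / ((R - t) / 2))
  filter_upwards [eventually_ge_atTop n₀] with n hn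
  filter_upwards [Iio_mem_nhds (show t < (R + t) / 2 by linarith)] with s hs
  apply Real.smoothTransition.one_of_one_le
  have h1 : 2 < n₀ * ((R - t) / 2) := (div_lt_iff₀ (by linarith)).1 hn₀
  have h2 : (n₀ : ℝ) ≤ n := by exact_mod_cast hn
  have h3 : (R - t) / 2 < R - s := by simp only [Set.mem_Iio] at hs; linarith
  have h4 : (n₀ : ℝ) * ((R - t) / 2) ≤ (n + 1) * (R - s) := by
    apply mul_le_mul (by linarith) h3.le (by linarith) (by positivity)
  linarith

/-- The truncations of a radial function. -/
def radialTest (N : ℕ) (F : ℝ → ℝ) (hF : ContDiff ℝ ∞ F) {r : ℝ} (hr : 0 < r) (n : ℕ) :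
    𝓓(ball0 N r, ℝ) :=
  have hK : IsCompact {x : Euc N | ‖x‖ ^ 2 ≤ r ^ 2 - 1 / (n + 1)} := by
    refine (isCompact_closedBall (0 : Euc N) r).of_isClosed_subset
      (isClosed_le (by fun_prop) continuous_const) fun x hx => ?_
    rw [mem_closedBall_zero_iff]
    have : (0 : ℝ) < 1 / (n + 1) := by positivity
    exact abs_le_of_sq_le_sq' (by simp only [Set.mem_ofPred_eq] at hx; linarith) hr.le |>.2
  have h0 : ∀ x ∉ {x : Euc N | ‖x‖ ^ 2 ≤ r ^ 2 - 1 / (n + 1)},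
      cutoff (r ^ 2) n (‖x‖ ^ 2) * F (‖x‖ ^ 2) = 0 := by
    intro x hx
    rw [Set.mem_ofPred_eq, not_le] at hx
    rw [cutoff, Real.smoothTransition.zero_of_nonpos, zero_mul]
    have h1 : r ^ 2 - ‖x‖ ^ 2 ≤ 1 / (n + 1) := by linarith
    have h2 : ((n : ℝ) + 1) * (1 / (n + 1)) = 1 := by field_simp
    have h3 : (0 : ℝ) ≤ n + 1 := by positivity
    nlinarith [mul_le_mul_of_nonneg_left h1 h3]
  { toFun := fun x => cutoff (r ^ 2) n (‖x‖ ^ 2) * F (‖x‖ ^ 2)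
    contDiff' := contDiff_comp_sq_norm ((contDiff_cutoff _ n).mul hF)
    hasCompactSupport' := HasCompactSupport.intro hK h0
    tsupport_subset' := by
      refine (closure_minimal (t := {x : Euc N | ‖x‖ ^ 2 ≤ r ^ 2 - 1 / (n + 1)})
        (fun x hx => ?_) hK.isClosed).trans fun x hx => ?_
      · by_contra h
        exact hx (h0 x h)
      · have : (0 : ℝ) < 1 / (n + 1) := by positivity
        change x ∈ Metric.ball 0 r
        rw [mem_ball_zero_iff]
        exact abs_lt_of_sq_lt_sq' (by simp only [Set.mem_ofPred_eq] at hx; linarith) hr.le |>.2 }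

/-! ### Radial functions in `H¹₀` and `H²₀` by truncation -/

section Approximation

variable {F : ℝ → ℝ}

lemma deriv_cutoff_mul (hF : ContDiff ℝ ∞ F) (R : ℝ) (n : ℕ) (t : ℝ) :
    deriv (fun t => cutoff R n t * F t) t
      = deriv (cutoff R n) t * F t + cutoff R n t * deriv F t :=
  deriv_fun_mul ((contDiff_cutoff R n).differentiable (by simp) t) (hF.differentiable (by simp) t)

lemma deriv_deriv_cutoff_mul (hF : ContDiff ℝ ∞ F) (R : ℝ) (n : ℕ) (t : ℝ) :
    deriv (deriv (fun t => cutoff R n t * F t)) t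
      = deriv (deriv (cutoff R n)) t * F t + 2 * (deriv (cutoff R n) t * deriv F t)
        + cutoff R n t * deriv (deriv F) t := by
  have hc := contDiff_cutoff R n
  have hc' := contDiff_deriv_of_contDiff hc
  have hF' := contDiff_deriv_of_contDiff hF
  rw [funext (deriv_cutoff_mul hF R n), deriv_fun_add ((hc'.mul hF).differentiable (by simp) t)
    ((hc.mul hF').differentiable (by simp) t), deriv_cutoff_mul hF',
    deriv_fun_mul (hc'.differentiable (by simp) t) (hF.differentiable (by simp) t)]
  ring

lemma sq_norm_mem {r : ℝ} {x : Euc N} (hx : x ∈ Metric.ball (0 : Euc N) r) :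
    ‖x‖ ^ 2 ∈ Set.Icc 0 (r ^ 2) ∧ ‖x‖ ^ 2 < r ^ 2 := by
  have h1 : ‖x‖ ^ 2 < r ^ 2 := by
    rw [mem_ball_zero_iff] at hx
    gcongr
  exact ⟨⟨by positivity, h1.le⟩, h1⟩

lemma abs_coord_le {r : ℝ} {x : Euc N} (hx : x ∈ Metric.ball (0 : Euc N) r) (i : Fin N) :
    |x i| ≤ r :=
  (PiLp.norm_apply_le x i).trans (mem_ball_zero_iff.1 hx).le

lemma exists_abs_le_on_Icc {f : ℝ → ℝ} (hf : Continuous f) (R : ℝ) :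
    ∃ C, 0 ≤ C ∧ ∀ t ∈ Set.Icc 0 R, |f t| ≤ C := by
  obtain ⟨C, hC⟩ := (isCompact_Icc (a := 0) (b := R)).exists_bound_of_continuousOn hf.continuousOn
  exact ⟨max C 0, le_max_right _ _, fun t ht => (hC t ht).trans (le_max_left _ _)⟩

lemma tendsto_radialTest (hF : ContDiff ℝ ∞ F) {r : ℝ} (hr : 0 < r) :
    Tendsto (fun n => eLpNorm (fun x => radialTest N F hF hr n x - F (‖x‖ ^ 2)) 2
      (volume.restrict (ball0 N r : Set (Euc N)))) atTop (𝓝 0) := by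
  obtain ⟨C, hC0, hC⟩ := exists_abs_le_on_Icc hF.continuous (r ^ 2)
  refine tendsto_eLpNorm_ball0_of_bounded (C := C) (contDiff_comp_sq_norm hF).continuous
    (fun n => (radialTest N F hF hr n).continuous) (fun n x hx => ?_) fun x hx => ?_
  · change |cutoff (r ^ 2) n (‖x‖ ^ 2) * F (‖x‖ ^ 2)| ≤ C
    rw [abs_mul]
    nlinarith [abs_cutoff_le (r ^ 2) n (‖x‖ ^ 2), hC _ (sq_norm_mem hx).1, abs_nonneg (F (‖x‖ ^ 2))]
  · filter_upwards [eventually_cutoff_eq_one (sq_norm_mem hx).2] with n hn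
    change cutoff (r ^ 2) n (‖x‖ ^ 2) * F (‖x‖ ^ 2) = _
    rw [hn.self_of_nhds, one_mul]

/-- The cutoff derivative is of order `n` near the sphere, but there `F = O(R - t)`, so the product
stays bounded. -/
lemma tendsto_partialDeriv_radialTest (hF : ContDiff ℝ ∞ F) {r : ℝ} (hr : 0 < r)
    (h0 : F (r ^ 2) = 0) (i : Fin N) :
    Tendsto (fun n => eLpNorm (fun x => partialDeriv i (radialTest N F hF hr n) x
      - partialDeriv i (fun x => F (‖x‖ ^ 2)) x) 2
      (volume.restrict (ball0 N r : Set (Euc N)))) atTop (𝓝 0) := by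
  obtain ⟨K, hK0, hK⟩ := exists_abs_le_mul_sub hF h0
  obtain ⟨C, hC0, hC⟩ := exists_abs_deriv_cutoff_mul_le
  obtain ⟨M, hM0, hM⟩ := exists_abs_le_on_Icc (contDiff_deriv_of_contDiff hF).continuous (r ^ 2)
  have hcF (n : ℕ) : ContDiff ℝ ∞ fun t => cutoff (r ^ 2) n t * F t := (contDiff_cutoff _ n).mul hF
  have hpd (n : ℕ) (x : Euc N) : partialDeriv i (radialTest N F hF hr n) x
      = 2 * x i * deriv (fun t => cutoff (r ^ 2) n t * F t) (‖x‖ ^ 2) :=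
    partialDeriv_comp_sq_norm (hcF n) i x
  refine tendsto_eLpNorm_ball0_of_bounded (C := 2 * r * (C * K + M))
    (ContDiff.partialDeriv (contDiff_comp_sq_norm hF) i).continuous
    (fun n => (ContDiff.partialDeriv (radialTest N F hF hr n).contDiff i).continuous)
    (fun n x hx => ?_) fun x hx => ?_
  · obtain ⟨ht, ht'⟩ := sq_norm_mem hx
    have h1 : |deriv (cutoff (r ^ 2) n) (‖x‖ ^ 2) * F (‖x‖ ^ 2)| ≤ C * K := by
      have := hC (r ^ 2) n (‖x‖ ^ 2)
      rw [abs_mul, abs_of_nonneg (sub_nonneg.2 ht.2)] at this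
      rw [abs_mul]
      calc _ ≤ |deriv (cutoff (r ^ 2) n) (‖x‖ ^ 2)| * (K * (r ^ 2 - ‖x‖ ^ 2)) := by
            gcongr; exact hK _ ht
        _ = |deriv (cutoff (r ^ 2) n) (‖x‖ ^ 2)| * (r ^ 2 - ‖x‖ ^ 2) * K := by ring
        _ ≤ C * K := by gcongr
    have h2 : |cutoff (r ^ 2) n (‖x‖ ^ 2) * deriv F (‖x‖ ^ 2)| ≤ M := by
      rw [abs_mul, ← one_mul M]
      gcongr
      · exact abs_cutoff_le _ _ _
      · exact hM _ ht
    rw [hpd, deriv_cutoff_mul hF, abs_mul, abs_mul, abs_two]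
    gcongr
    · exact abs_coord_le hx i
    · exact (abs_add_le _ _).trans (add_le_add h1 h2)
  · filter_upwards [eventually_cutoff_eq_one (sq_norm_mem hx).2] with n hn
    rw [hpd, partialDeriv_comp_sq_norm hF]
    congr 1
    refine Filter.EventuallyEq.deriv_eq ?_
    filter_upwards [hn] with s hs
    rw [hs, one_mul]

/-- The product rule yields `χ'' F`, `χ' F'` and `χ F''`, as well as first-order terms when `i = j`.
Second-order vanishing of `F` at the boundary balances `χ''`, and first-order vanishing of `F'`
balances `χ'`. -/
lemma tendsto_partialDeriv_partialDeriv_radialTest (hF : ContDiff ℝ ∞ F) {r : ℝ} (hr : 0 < r)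
    (h0 : F (r ^ 2) = 0) (h1 : deriv F (r ^ 2) = 0) (i j : Fin N) :
    Tendsto (fun n => eLpNorm (fun x => partialDeriv j (partialDeriv i (radialTest N F hF hr n)) x
      - partialDeriv j (partialDeriv i (fun x => F (‖x‖ ^ 2))) x) 2
      (volume.restrict (ball0 N r : Set (Euc N)))) atTop (𝓝 0) := by
  have hF' := contDiff_deriv_of_contDiff hF
  obtain ⟨K, hK0, hK⟩ := exists_abs_le_mul_sub hF h0
  obtain ⟨K₁, hK₁0, hK₁⟩ := exists_abs_le_mul_sub hF' h1
  obtain ⟨K₂, hK₂0, hK₂⟩ := exists_abs_le_mul_sub_sq hF h0 h1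
  obtain ⟨C, hC0, hC⟩ := exists_abs_deriv_cutoff_mul_le
  obtain ⟨D, hD0, hD⟩ := exists_abs_deriv_deriv_cutoff_mul_le
  obtain ⟨M, hM0, hM⟩ := exists_abs_le_on_Icc hF'.continuous (r ^ 2)
  obtain ⟨M₂, hM₂0, hM₂⟩ :=
    exists_abs_le_on_Icc (contDiff_deriv_of_contDiff hF').continuous (r ^ 2)
  have hcF (n : ℕ) : ContDiff ℝ ∞ fun t => cutoff (r ^ 2) n t * F t := (contDiff_cutoff _ n).mul hF
  have hpd (n : ℕ) (x : Euc N) : partialDeriv j (partialDeriv i (radialTest N F hF hr n)) x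
      = 4 * x i * x j * deriv (deriv (fun t => cutoff (r ^ 2) n t * F t)) (‖x‖ ^ 2)
        + if i = j then 2 * deriv (fun t => cutoff (r ^ 2) n t * F t) (‖x‖ ^ 2) else 0 :=
    partialDeriv_partialDeriv_comp_sq_norm (hcF n) i j x
  refine tendsto_eLpNorm_ball0_of_bounded
    (C := 4 * r * r * (D * K₂ + 2 * (C * K₁) + M₂) + 2 * (C * K + M))
    (ContDiff.partialDeriv (ContDiff.partialDeriv (contDiff_comp_sq_norm hF) i) j).continuous
    (fun n => (ContDiff.partialDeriv
      (ContDiff.partialDeriv (radialTest N F hF hr n).contDiff i) j).continuous)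
    (fun n x hx => ?_) fun x hx => ?_
  · obtain ⟨ht, ht'⟩ := sq_norm_mem hx
    have hCn := hC (r ^ 2) n (‖x‖ ^ 2)
    rw [abs_mul, abs_of_nonneg (sub_nonneg.2 ht.2)] at hCn
    have hDn := hD (r ^ 2) n (‖x‖ ^ 2)
    rw [abs_mul, abs_of_nonneg (sq_nonneg (r ^ 2 - ‖x‖ ^ 2))] at hDn
    have b1 : |deriv (cutoff (r ^ 2) n) (‖x‖ ^ 2) * F (‖x‖ ^ 2)| ≤ C * K := by
      rw [abs_mul]
      calc _ ≤ |deriv (cutoff (r ^ 2) n) (‖x‖ ^ 2)| * (K * (r ^ 2 - ‖x‖ ^ 2)) := by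
            gcongr; exact hK _ ht
        _ = |deriv (cutoff (r ^ 2) n) (‖x‖ ^ 2)| * (r ^ 2 - ‖x‖ ^ 2) * K := by ring
        _ ≤ C * K := by gcongr
    have b2 : |deriv (cutoff (r ^ 2) n) (‖x‖ ^ 2) * deriv F (‖x‖ ^ 2)| ≤ C * K₁ := by
      rw [abs_mul]
      calc _ ≤ |deriv (cutoff (r ^ 2) n) (‖x‖ ^ 2)| * (K₁ * (r ^ 2 - ‖x‖ ^ 2)) := by
            gcongr; exact hK₁ _ ht
        _ = |deriv (cutoff (r ^ 2) n) (‖x‖ ^ 2)| * (r ^ 2 - ‖x‖ ^ 2) * K₁ := by ring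
        _ ≤ C * K₁ := by gcongr
    have b3 : |deriv (deriv (cutoff (r ^ 2) n)) (‖x‖ ^ 2) * F (‖x‖ ^ 2)| ≤ D * K₂ := by
      rw [abs_mul]
      calc _ ≤ |deriv (deriv (cutoff (r ^ 2) n)) (‖x‖ ^ 2)| * (K₂ * (r ^ 2 - ‖x‖ ^ 2) ^ 2) := by
            gcongr; exact hK₂ _ ht
        _ = |deriv (deriv (cutoff (r ^ 2) n)) (‖x‖ ^ 2)| * (r ^ 2 - ‖x‖ ^ 2) ^ 2 * K₂ := by ring
        _ ≤ D * K₂ := by gcongr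
    have b4 : |cutoff (r ^ 2) n (‖x‖ ^ 2) * deriv F (‖x‖ ^ 2)| ≤ M := by
      rw [abs_mul, ← one_mul M]
      gcongr
      · exact abs_cutoff_le _ _ _
      · exact hM _ ht
    have b5 : |cutoff (r ^ 2) n (‖x‖ ^ 2) * deriv (deriv F) (‖x‖ ^ 2)| ≤ M₂ := by
      rw [abs_mul, ← one_mul M₂]
      gcongr
      · exact abs_cutoff_le _ _ _
      · exact hM₂ _ ht
    rw [hpd, deriv_cutoff_mul hF, deriv_deriv_cutoff_mul hF]
    refine (abs_add_le _ _).trans (add_le_add ?_ ?_)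
    · rw [abs_mul, abs_mul, abs_mul, abs_of_pos (by norm_num : (0 : ℝ) < 4)]
      gcongr
      · exact abs_coord_le hx i
      · exact abs_coord_le hx j
      · refine (abs_add_le _ _).trans (add_le_add ((abs_add_le _ _).trans (add_le_add b3 ?_)) b5)
        rw [abs_mul, abs_two]
        gcongr
    · split_ifs
      · rw [abs_mul, abs_two]
        gcongr
        exact (abs_add_le _ _).trans (add_le_add b1 b4)
      · rw [abs_zero]; positivity
  · filter_upwards [eventually_cutoff_eq_one (sq_norm_mem hx).2] with n hn
    rw [hpd, partialDeriv_partialDeriv_comp_sq_norm hF]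
    have e : (fun t => cutoff (r ^ 2) n t * F t) =ᶠ[𝓝 (‖x‖ ^ 2)] F := by
      filter_upwards [hn] with s hs
      rw [hs, one_mul]
    rw [e.deriv_eq, e.deriv.deriv_eq]

lemma memH10_radial (hF : ContDiff ℝ ∞ F) {r : ℝ} (hr : 0 < r) (h0 : F (r ^ 2) = 0) :
    (radial N F hF r).MemH10 :=
  ⟨radialTest N F hF hr, tendsto_radialTest hF hr, tendsto_partialDeriv_radialTest hF hr h0⟩

lemma memH20_radial (hF : ContDiff ℝ ∞ F) {r : ℝ} (hr : 0 < r) (h0 : F (r ^ 2) = 0)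
    (h1 : deriv F (r ^ 2) = 0) : (radial N F hF r).MemH20 :=
  ⟨radialTest N F hF hr, tendsto_radialTest hF hr, tendsto_partialDeriv_radialTest hF hr h0,
    tendsto_partialDeriv_partialDeriv_radialTest hF hr h0 h1⟩

end Approximation

/-! ### Explicit radial solutions -/

/-- The entire function `J` with `Δ (J (‖x‖ ^ 2)) = - J (‖x‖ ^ 2)` on `ℝ^N` and `J 0 = 1`. -/
def besselJ (N : ℕ) : ℝ → ℝ := normBessel (N / 2)

/-- The entire function `K = -2 N J'`. -/
def besselK (N : ℕ) : ℝ → ℝ := normBessel (N / 2 + 1)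

lemma half_le_half_cast (hN : 1 ≤ N) : (1 / 2 : ℝ) ≤ N / 2 := by
  have : (1 : ℝ) ≤ N := by exact_mod_cast hN
  linarith

lemma contDiff_besselJ (hN : 1 ≤ N) : ContDiff ℝ ∞ (besselJ N) :=
  contDiff_normBessel (half_le_half_cast hN)

lemma contDiff_besselK (hN : 1 ≤ N) : ContDiff ℝ ∞ (besselK N) :=
  contDiff_normBessel (by linarith [half_le_half_cast hN])

lemma hasDerivAt_besselJ (hN : 1 ≤ N) (t : ℝ) :
    HasDerivAt (besselJ N) (-(besselK N t / (2 * N))) t := by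
  convert! hasDerivAt_normBessel (half_le_half_cast hN) t using 1
  rw [besselK]
  ring

/-- The contiguity relation at `ν = N / 2`, rewritten as an ODE. With `J' = -K / (2N)` it closes the
system for `J` and `K`, so no further Bessel functions appear. -/
lemma mul_deriv_besselK (hN : 1 ≤ N) (t : ℝ) :
    t * deriv (besselK N) t = N / 2 * (besselJ N t - besselK N t) := by
  have hν := half_le_half_cast hN
  have hN0 : (N : ℝ) ≠ 0 := by positivity
  have hN2 : (N : ℝ) / 2 + 1 ≠ 0 := by positivity
  rw [besselK, (hasDerivAt_normBessel (ν := N / 2 + 1) (by linarith) t).deriv, besselJ,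
    normBessel_recurrence hν, show (N : ℝ) / 2 + 1 + 1 = N / 2 + 2 by ring]
  field_simp
  ring

/-- A family of profiles of radial functions that is stable under the Laplacian. -/
def profile (N : ℕ) (σ e c d β s : ℝ) : ℝ := e * s ^ 2 + c * s + d + β * besselJ N (σ ^ 2 * s)

lemma contDiff_profile (hN : 1 ≤ N) (σ e c d β : ℝ) : ContDiff ℝ ∞ (profile N σ e c d β) := by
  have := contDiff_besselJ hN
  unfold profile
  fun_prop

lemma hasDerivAt_profile (hN : 1 ≤ N) (σ e c d β s : ℝ) :
    HasDerivAt (profile N σ e c d β)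
      (2 * e * s + c - β * σ ^ 2 / (2 * N) * besselK N (σ ^ 2 * s)) s := by
  have h0 : HasDerivAt (fun s => σ ^ 2 * s) (σ ^ 2) s := by
    simpa using (hasDerivAt_id s).const_mul (σ ^ 2)
  have h1 := (hasDerivAt_besselJ hN (σ ^ 2 * s)).comp s h0
  convert! ((((hasDerivAt_pow 2 s).const_mul e).add ((hasDerivAt_id s).const_mul c)).add_const
    d).add (h1.const_mul β) using 1
  simp
  ring

lemma deriv_profile (hN : 1 ≤ N) (σ e c d β : ℝ) : deriv (profile N σ e c d β)
    = fun s => 2 * e * s + c - β * σ ^ 2 / (2 * N) * besselK N (σ ^ 2 * s) :=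
  funext fun s => (hasDerivAt_profile hN σ e c d β s).deriv

lemma deriv_deriv_profile (hN : 1 ≤ N) (σ e c d β s : ℝ) :
    deriv (deriv (profile N σ e c d β)) s
      = 2 * e - β * σ ^ 2 / (2 * N) * (deriv (besselK N) (σ ^ 2 * s) * σ ^ 2) := by
  have h0 : HasDerivAt (fun s => σ ^ 2 * s) (σ ^ 2) s := by
    simpa using (hasDerivAt_id s).const_mul (σ ^ 2)
  have h1 := ((contDiff_besselK hN).differentiable (by simp) (σ ^ 2 * s)).hasDerivAt.comp s h0
  rw [deriv_profile hN]
  refine HasDerivAt.deriv ?_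
  convert! (((hasDerivAt_id s).const_mul (2 * e)).add_const c).sub
    (h1.const_mul (β * σ ^ 2 / (2 * N))) using 1
  simp

/-- The Bessel part is an eigenfunction with eigenvalue `-σ²`. The quartic term `e` is carried along
only so that profiles without it are themselves Laplacians. -/
lemma lap_profile (hN : 1 ≤ N) (σ e c d β : ℝ) :
    lap (fun x : Euc N => profile N σ e c d β (‖x‖ ^ 2))
      = fun x => profile N σ 0 (4 * (N + 2) * e) (2 * N * c) (-β * σ ^ 2) (‖x‖ ^ 2) := by
  ext x
  rw [lap_comp_sq_norm (contDiff_profile hN σ e c d β), deriv_deriv_profile hN, deriv_profile hN]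
  have h := mul_deriv_besselK hN (σ ^ 2 * ‖x‖ ^ 2)
  have hN0 : (N : ℝ) ≠ 0 := by positivity
  have e1 : 4 * ‖x‖ ^ 2 * (β * σ ^ 2 / (2 * N) * (deriv (besselK N) (σ ^ 2 * ‖x‖ ^ 2) * σ ^ 2))
      = 2 * β * σ ^ 2 / N * (σ ^ 2 * ‖x‖ ^ 2 * deriv (besselK N) (σ ^ 2 * ‖x‖ ^ 2)) := by
    field_simp; ring
  rw [mul_sub, e1, h, profile]
  field_simp
  ring

/-- The radial solution of `Δ²u + σ²Δu = 2 N σ² c` that vanishes on the sphere of radius `r`. -/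
def plate (hN : 1 ≤ N) (σ c β r : ℝ) : H2Function (ball0 N r) :=
  radial N (profile N σ 0 c (-(c * r ^ 2) - β * besselJ N (σ ^ 2 * r ^ 2)) β)
    (contDiff_profile hN _ _ _ _ _) r

lemma memH10_plate (hN : 1 ≤ N) (σ c β : ℝ) {r : ℝ} (hr : 0 < r) : (plate hN σ c β r).MemH10 :=
  memH10_radial _ hr (by rw [profile]; ring)

/-- The normal derivative of `plate`. -/
def plateSlope (N : ℕ) (σ c β r : ℝ) : ℝ :=
  2 * r * (c - β * σ ^ 2 / (2 * N) * besselK N (σ ^ 2 * r ^ 2))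

/-- The boundary value of the Laplacian of `plate`. -/
def plateMoment (N : ℕ) (σ c β r : ℝ) : ℝ :=
  2 * N * c - β * σ ^ 2 * besselJ N (σ ^ 2 * r ^ 2)

/-- The integral of `plate`, divided by the area of the unit sphere. -/
def plateVolume (N : ℕ) (σ c β r : ℝ) : ℝ :=
  2 * r ^ N * (c * (r ^ 2 / (2 * (N + 2)) - r ^ 2 / (2 * N))
    + β / (2 * N) * (besselK N (σ ^ 2 * r ^ 2) - besselJ N (σ ^ 2 * r ^ 2)))

lemma hasNormalDeriv_plate (hN : 1 ≤ N) (σ c β : ℝ) {r : ℝ} (hr : 0 ≤ r) :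
    HasNormalDeriv (plate hN σ c β r) (plateSlope N σ c β r) := by
  have h := hasNormalDeriv_radial hN (contDiff_profile hN σ 0 c
    (-(c * r ^ 2) - β * besselJ N (σ ^ 2 * r ^ 2)) β) hr
  rw [deriv_profile hN] at h
  convert! h using 1
  rw [plateSlope]
  ring

lemma memH20_plate (hN : 1 ≤ N) {σ c β r : ℝ} (hr : 0 < r) (h : plateSlope N σ c β r = 0) :
    (plate hN σ c β r).MemH20 := by
  refine memH20_radial _ hr (by rw [profile]; ring) ?_
  rw [deriv_profile hN]
  rw [plateSlope] at h
  have := (mul_eq_zero.1 h).resolve_left (by positivity)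
  linarith

/-- The integrand is the Laplacian of another profile, so Green's formula with test function `1`
reduces the integral to a normal derivative. Inverting the Laplacian divides `β` by `-σ²`, whence `σ
≠ 0`. -/
lemma integral_profile (hN : 1 ≤ N) {σ c β r : ℝ} (hσ : σ ≠ 0) (hr : 0 ≤ r) :
    ∫ x : Euc N in ball0 N r,
      profile N σ 0 c (-(c * r ^ 2) - β * besselJ N (σ ^ 2 * r ^ 2)) β (‖x‖ ^ 2)
      = plateVolume N σ c β r * sphereArea N := by
  have hN0 : (N : ℝ) ≠ 0 := by positivity
  have hN2 : (N : ℝ) + 2 ≠ 0 := by positivity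
  set d := -(c * r ^ 2) - β * besselJ N (σ ^ 2 * r ^ 2) with hd
  have h := hasNormalDeriv_radial hN (contDiff_profile hN σ (c / (4 * (N + 2))) (d / (2 * N)) 0
    (-β / σ ^ 2)) hr (fun _ => 1) contDiff_const
  have hc (i : Fin N) (x : Euc N) : partialDeriv i (fun _ => (1 : ℝ)) x = 0 := by
    simp [partialDeriv]
  rw [sphereIntegral_of_const hr fun x _ => rfl, deriv_profile hN] at h
  simp only [hc, zero_mul, Finset.sum_const_zero, add_zero, one_mul, mul_one, radial,
    H2Function.ofSmooth_laplacian, lap_profile hN] at h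
  have e1 : 4 * ((N : ℝ) + 2) * (c / (4 * (N + 2))) = c := by field_simp
  have e2 : 2 * (N : ℝ) * (d / (2 * N)) = d := by field_simp
  have e3 : -(-β / σ ^ 2) * σ ^ 2 = β := by field_simp
  rw [e1, e2, e3] at h
  rw [h, hd, plateVolume]
  obtain ⟨n, rfl⟩ : ∃ n, N = n + 1 := ⟨N - 1, by omega⟩
  rw [Nat.add_sub_cancel]
  field_simp
  ring

lemma plate_pde (hN : 1 ≤ N) (σ c d β : ℝ) (x : Euc N) :
    lap (lap fun x : Euc N => profile N σ 0 c d β (‖x‖ ^ 2)) x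
      + σ ^ 2 * lap (fun x : Euc N => profile N σ 0 c d β (‖x‖ ^ 2)) x = 2 * N * σ ^ 2 * c := by
  rw [lap_profile hN, lap_profile hN]
  simp only [profile]
  ring

lemma plate_moment (hN : 1 ≤ N) (σ c d β : ℝ) {r : ℝ} {x : Euc N} (hx : ‖x‖ = r) :
    lap (fun x : Euc N => profile N σ 0 c d β (‖x‖ ^ 2)) x = plateMoment N σ c β r := by
  rw [lap_profile hN, plateMoment]
  simp only [profile, hx]
  ring

lemma plateEnergy_plate (hN : 1 ≤ N) {σ α c β r : ℝ} (hσ : σ ≠ 0) (hr : 0 < r)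
    (hα : 2 * N * σ ^ 2 * c = α) :
    (plate hN σ c β r).plateEnergy σ α = (-(α / 2) * plateVolume N σ c β r
      + r ^ (N - 1) * (plateSlope N σ c β r / 2) * plateMoment N σ c β r) * sphereArea N := by
  refine (H2Function.plateEnergy_ofSmooth hr.le
    (contDiff_comp_sq_norm (contDiff_profile hN _ _ _ _ _)) (fun x => (plate_pde hN σ c _ β x).trans hα)
    (fun x hx => plate_moment hN σ c _ β hx) (memH10_plate hN σ c β hr)
    (hasNormalDeriv_plate hN σ c β hr.le)).trans ?_
  rw [integral_profile hN hσ hr.le]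
  ring

lemma plate_le_plateEnergy (hN : 1 ≤ N) {σ α c β r p : ℝ} (hσ : σ ≠ 0) (hr : 0 < r)
    (hσr : 4 * r ^ 2 * σ ^ 2 ≤ 1) (hα : 2 * N * σ ^ 2 * c = α) {v : H2Function (ball0 N r)}
    (hv : v.MemH10) (hp : HasNormalDeriv v p) :
    (-(α / 2) * plateVolume N σ c β r
      + r ^ (N - 1) * (p - plateSlope N σ c β r / 2) * plateMoment N σ c β r) * sphereArea N
      ≤ v.plateEnergy σ α := by
  refine le_trans (le_of_eq ?_) (H2Function.le_plateEnergy hN hr hσr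
    (contDiff_comp_sq_norm (contDiff_profile hN _ _ _ _ _))
    (fun x => (plate_pde hN σ c _ β x).trans hα)
    (fun x hx => plate_moment hN σ c _ β hx) (memH10_plate hN σ c β hr)
    (hasNormalDeriv_plate hN σ c β hr.le) hv hp)
  rw [integral_profile hN hσ hr.le]
  ring

/-! ### The two-ball energy -/

/-- The quotient `K / J` at the boundary of the second ball. -/
def quotientB (N : ℕ) (σ a : ℝ) : ℝ :=
  besselK N (σ ^ 2 * radiusB N a ^ 2) / besselJ N (σ ^ 2 * radiusB N a ^ 2)

/-- The coefficient of the Bessel function in the minimizer on the first ball. -/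
def coeffA (N : ℕ) (σ a : ℝ) : ℝ :=
  1 / σ ^ 4 * ((a ^ N + (1 - a ^ N) * quotientB N σ a)
    / (a ^ N * besselK N (σ ^ 2 * a ^ 2)
      + (1 - a ^ N) * quotientB N σ a * besselJ N (σ ^ 2 * a ^ 2)))

/-- The coefficient of the Bessel function in the minimizer on the second ball. -/
def coeffB (N : ℕ) (σ a : ℝ) : ℝ :=
  (1 / σ ^ 4 - coeffA N σ a * besselJ N (σ ^ 2 * a ^ 2)) / besselJ N (σ ^ 2 * radiusB N a ^ 2)

/-- The explicit value of the two-ball energy. -/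
def energyFormula (N : ℕ) (σ a : ℝ) : ℝ :=
  -(1 / 2) * plateVolume N σ (1 / (2 * N * σ ^ 2)) (coeffA N σ a) a * sphereArea N

lemma radiusB_pow (hN : 1 ≤ N) {a : ℝ} (ha0 : 0 ≤ a) (ha1 : a ≤ 1) :
    radiusB N a ^ N = 1 - a ^ N := by
  have h : 0 ≤ 1 - a ^ N := sub_nonneg.2 (pow_le_one₀ ha0 ha1)
  rw [radiusB, one_div, Real.rpow_inv_natCast_pow h (by omega)]

lemma radiusB_pos (hN : 1 ≤ N) {a : ℝ} (ha0 : 0 ≤ a) (ha1 : a < 1) : 0 < radiusB N a :=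
  Real.rpow_pos_of_pos (sub_pos.2 (pow_lt_one₀ ha0 ha1 (by omega))) _

lemma radiusB_le_one {a : ℝ} (ha0 : 0 ≤ a) (ha1 : a ≤ 1) : radiusB N a ≤ 1 :=
  Real.rpow_le_one (sub_nonneg.2 (pow_le_one₀ ha0 ha1)) (by linarith [pow_nonneg ha0 N])
    (by positivity)

lemma radiusB_one (hN : 1 ≤ N) : radiusB N 1 = 0 := by
  rw [radiusB, one_pow, sub_self, Real.zero_rpow]
  positivity

lemma quotientB_one (hN : 1 ≤ N) (σ : ℝ) : quotientB N σ 1 = 1 := by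
  simp [quotientB, radiusB_one hN, besselJ, besselK, normBessel_zero]

lemma coeffA_one (σ : ℝ) :
    coeffA N σ 1 = 1 / σ ^ 4 * (1 / besselK N (σ ^ 2)) := by
  simp [coeffA]

/-! ### The explicit plates are minimizers -/

section Minimum

variable {σ : ℝ}

lemma isLeast_energyValues_of_lt_one (hN : 1 ≤ N) (hσ : 0 < σ) (hσ1 : 4 * σ ^ 2 ≤ 1)
    (hpos : ∀ t ∈ Set.Icc 0 (σ ^ 2), 0 < besselJ N t ∧ 0 < besselK N t) {a : ℝ} (ha0 : 0 < a)
    (ha1 : a < 1) : IsLeast (energyValues N a σ) (energyFormula N σ a) := by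
  have hN0 : (0 : ℝ) < N := by exact_mod_cast hN
  set b := radiusB N a with hb
  have hb0 : 0 < b := radiusB_pos hN ha0.le ha1
  have hb1 : b ≤ 1 := radiusB_le_one ha0.le ha1.le
  have hbN : b ^ N = 1 - a ^ N := radiusB_pow hN ha0.le ha1.le
  have haN : 0 < a ^ N := by positivity
  have hbN' : 0 < b ^ N := by positivity
  have hsq (r : ℝ) (hr0 : 0 < r) (hr1 : r ≤ 1) : r ^ 2 ≤ 1 := pow_le_one₀ hr0.le hr1
  have hmem (r : ℝ) (hr0 : 0 < r) (hr1 : r ≤ 1) : σ ^ 2 * r ^ 2 ∈ Set.Icc 0 (σ ^ 2) :=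
    ⟨by positivity, by nlinarith [hsq r hr0 hr1, sq_nonneg σ]⟩
  have hsm (r : ℝ) (hr0 : 0 < r) (hr1 : r ≤ 1) : 4 * r ^ 2 * σ ^ 2 ≤ 1 := by
    nlinarith [hsq r hr0 hr1, sq_nonneg σ]
  obtain ⟨hA, hKa⟩ := hpos _ (hmem a ha0 ha1.le)
  obtain ⟨hB, hKb⟩ := hpos _ (hmem b hb0 hb1)
  set c := 1 / (2 * N * σ ^ 2) with hc
  set β := coeffA N σ a with hβ
  set δ := coeffB N σ a with hδ
  have hα : 2 * N * σ ^ 2 * c = 1 := by rw [hc]; field_simp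
  -- The natural boundary condition; it is the equation that determines `δ` from `β`.
  have hmoment : plateMoment N σ c β a + plateMoment N σ 0 δ b = 0 := by
    have h : δ * besselJ N (σ ^ 2 * b ^ 2) = 1 / σ ^ 4 - β * besselJ N (σ ^ 2 * a ^ 2) := by
      rw [hδ, coeffB, ← hb, div_mul_cancel₀ _ hB.ne']
    rw [plateMoment, plateMoment, mul_right_comm δ, h, hc]
    field_simp
    ring
  -- The flux constraint divided by `2`. After substituting `δ` it is linear in `β`, and positivity
  -- of `J` and `K` keeps the coefficient of `β` nonzero.
  have hslope : a ^ N * (c - β * σ ^ 2 / (2 * N) * besselK N (σ ^ 2 * a ^ 2))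
      = b ^ N * (0 - δ * σ ^ 2 / (2 * N) * besselK N (σ ^ 2 * b ^ 2)) := by
    have hden : 0 < a ^ N * besselK N (σ ^ 2 * a ^ 2)
        + b ^ N * (besselK N (σ ^ 2 * b ^ 2) / besselJ N (σ ^ 2 * b ^ 2))
          * besselJ N (σ ^ 2 * a ^ 2) := by positivity
    have h : β * (a ^ N * besselK N (σ ^ 2 * a ^ 2)
        + b ^ N * (besselK N (σ ^ 2 * b ^ 2) / besselJ N (σ ^ 2 * b ^ 2))
          * besselJ N (σ ^ 2 * a ^ 2))
        = 1 / σ ^ 4 * (a ^ N + b ^ N * (besselK N (σ ^ 2 * b ^ 2) / besselJ N (σ ^ 2 * b ^ 2))) := by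
      rw [hβ, coeffA, quotientB, ← hb, ← hbN, mul_assoc (1 / σ ^ 4), div_mul_cancel₀ _ hden.ne']
    have h2 : δ * besselK N (σ ^ 2 * b ^ 2) = (1 / σ ^ 4 - β * besselJ N (σ ^ 2 * a ^ 2))
        * (besselK N (σ ^ 2 * b ^ 2) / besselJ N (σ ^ 2 * b ^ 2)) := by
      rw [hδ, coeffB, ← hb]; ring
    have h3 : a ^ N * (c - β * σ ^ 2 / (2 * N) * besselK N (σ ^ 2 * a ^ 2))
      - b ^ N * (0 - δ * σ ^ 2 / (2 * N) * besselK N (σ ^ 2 * b ^ 2))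
      = σ ^ 2 / (2 * N) * (a ^ N * (1 / σ ^ 4) - β * (a ^ N * besselK N (σ ^ 2 * a ^ 2))
        + b ^ N * (δ * besselK N (σ ^ 2 * b ^ 2))) := by
      rw [hc]; field_simp; ring
    rw [h2] at h3
    have h4 : a ^ N * (1 / σ ^ 4) - β * (a ^ N * besselK N (σ ^ 2 * a ^ 2))
        + b ^ N * ((1 / σ ^ 4 - β * besselJ N (σ ^ 2 * a ^ 2))
        * (besselK N (σ ^ 2 * b ^ 2) / besselJ N (σ ^ 2 * b ^ 2))) = 0 := by linear_combination -h
    rw [h4, mul_zero] at h3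
    linarith
  have hsl (r p : ℝ) : r ^ (N - 1) * (2 * r * p) = 2 * (r ^ N * p) := by
    obtain ⟨n, rfl⟩ : ∃ n, N = n + 1 := ⟨N - 1, by omega⟩
    rw [Nat.add_sub_cancel]; ring
  have hslope' : a ^ (N - 1) * plateSlope N σ c β a = b ^ (N - 1) * plateSlope N σ 0 δ b := by
    rw [plateSlope, plateSlope, hsl, hsl, hslope]
  have hm : plateMoment N σ 0 δ b = - plateMoment N σ c β a := by linarith
  rw [energyValues, if_pos ha1]
  refine ⟨⟨plate hN σ c β a, plate hN σ 0 δ b, ⟨memH10_plate hN σ c β ha0,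
    memH10_plate hN σ 0 δ hb0, _, _, hasNormalDeriv_plate hN σ c β ha0.le,
    hasNormalDeriv_plate hN σ 0 δ hb0.le, hslope'⟩, ?_⟩, ?_⟩
  · rw [plateEnergy_plate hN hσ.ne' ha0 hα, plateEnergy_plate hN hσ.ne' hb0 (mul_zero _), hm,
      energyFormula]
    linear_combination (-1 / 2 * plateMoment N σ c β a * sphereArea N) * hslope'
  · rintro e ⟨f, g, ⟨hf, hg, p, q, hp, hq, hpq⟩, rfl⟩
    have h1 := plate_le_plateEnergy hN (β := β) hσ.ne' ha0 (hsm a ha0 ha1.le) hα hf hp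
    have h2 := plate_le_plateEnergy hN (β := δ) hσ.ne' hb0 (hsm b hb0 hb1) (mul_zero _) hg hq
    rw [hm] at h2
    refine le_trans (le_of_eq ?_) (add_le_add h1 h2)
    rw [energyFormula]
    -- The moments are opposite, so the unknown slopes `p` and `q` enter only through `a^(N-1) p -
    -- b^(N-1) q = 0`.
    linear_combination (1 / 2 * plateMoment N σ c β a * sphereArea N) * hslope'
      - (plateMoment N σ c β a * sphereArea N) * hpq

/-- Here `coeffA N σ 1` is the coefficient that makes the plate clamped. Candidate and competitor
both have zero slope, so no condition on the moment is needed. -/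
lemma isLeast_energyValues_one (hN : 1 ≤ N) (hσ : 0 < σ) (hσ1 : 4 * σ ^ 2 ≤ 1)
    (hK : 0 < besselK N (σ ^ 2)) : IsLeast (energyValues N 1 σ) (energyFormula N σ 1) := by
  have hN0 : (0 : ℝ) < N := by exact_mod_cast hN
  set c := 1 / (2 * N * σ ^ 2) with hc
  set β := coeffA N σ 1 with hβ
  have hα : 2 * N * σ ^ 2 * c = 1 := by rw [hc]; field_simp
  have hs : plateSlope N σ c β 1 = 0 := by
    rw [plateSlope, hβ, coeffA_one, hc, one_pow, mul_one]
    field_simp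
    ring
  rw [energyValues, if_neg (lt_irrefl 1)]
  refine ⟨⟨plate hN σ c β 1, memH20_plate hN one_pos hs, ?_⟩, ?_⟩
  · rw [plateEnergy_plate hN hσ.ne' one_pos hα, hs, energyFormula]
    ring
  · rintro e ⟨f, hf, rfl⟩
    have h := plate_le_plateEnergy hN (β := β) hσ.ne' one_pos (by linarith) hα hf.memH10
      hf.hasNormalDeriv
    rw [hs] at h
    refine le_trans (le_of_eq ?_) h
    rw [energyFormula]
    ring

end Minimum

/-! ### The derivative at `a = 1` -/

/-- Since `f` vanishes at `x`, the difference quotient of the product is that of `f` times `g y`, so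
continuity of `g` suffices. This matters because `radiusB` has infinite slope at `a = 1` when `N ≥
2`. -/
lemma hasDerivWithinAt_mul_of_eq_zero {f g : ℝ → ℝ} {f' x : ℝ} {s : Set ℝ}
    (hf : HasDerivWithinAt f f' s x) (h0 : f x = 0) (hg : ContinuousWithinAt g s x) :
    HasDerivWithinAt (fun y => f y * g y) (f' * g x) s x := by
  rw [hasDerivWithinAt_iff_tendsto_slope] at hf ⊢
  refine (hf.mul (hg.mono_left (nhdsWithin_mono x Set.sdiff_subset))).congr fun y => ?_
  simp only [slope_def_field, h0, zero_mul, sub_zero]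
  ring

lemma continuousAt_quotientB_one (hN : 1 ≤ N) (σ : ℝ) : ContinuousAt (quotientB N σ) 1 := by
  have hr : Continuous fun a => σ ^ 2 * radiusB N a ^ 2 := by
    refine continuous_const.mul (Continuous.pow ?_ 2)
    exact (continuous_const.sub (continuous_pow N)).rpow_const fun _ => Or.inr (by positivity)
  refine ((contDiff_besselK hN).continuous.comp hr).continuousAt.div
    ((contDiff_besselJ hN).continuous.comp hr).continuousAt ?_
  simp [radiusB_one hN, besselJ, normBessel_zero]

lemma hasDerivWithinAt_energyFormula (hN : 1 ≤ N) {σ : ℝ} (hσ : 0 < σ)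
    (hK : 0 < besselK N (σ ^ 2)) (s : Set ℝ) :
    HasDerivWithinAt (energyFormula N σ) 0 s 1 := by
  have hN0 : (0 : ℝ) < N := by exact_mod_cast hN
  have hpow : HasDerivWithinAt (fun a : ℝ => a ^ N) N s 1 := by
    simpa using (hasDerivAt_pow N (1 : ℝ)).hasDerivWithinAt
  have hsq : HasDerivAt (fun a : ℝ => a ^ 2) 2 1 := by
    simpa using hasDerivAt_pow 2 (1 : ℝ)
  have hsq' : HasDerivAt (fun a : ℝ => σ ^ 2 * a ^ 2) (2 * σ ^ 2) 1 := by
    convert! hsq.const_mul (σ ^ 2) using 1; ring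
  have e1 : σ ^ 2 * (1 : ℝ) ^ 2 = σ ^ 2 := by ring
  have hJ : HasDerivWithinAt (fun a => besselJ N (σ ^ 2 * a ^ 2))
      (-(besselK N (σ ^ 2) / N) * σ ^ 2) s 1 := by
    have h := hasDerivAt_besselJ hN (σ ^ 2 * (1 : ℝ) ^ 2)
    have := (h.comp 1 hsq').hasDerivWithinAt (s := s)
    convert! this using 1
    rw [e1]; field_simp
  have hKd : HasDerivWithinAt (fun a => besselK N (σ ^ 2 * a ^ 2))
      (N * (besselJ N (σ ^ 2) - besselK N (σ ^ 2))) s 1 := by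
    have h := ((contDiff_besselK hN).differentiable (by simp) (σ ^ 2 * (1 : ℝ) ^ 2)).hasDerivAt
    have := (h.comp 1 hsq').hasDerivWithinAt (s := s)
    convert! this using 1
    have := mul_deriv_besselK hN (σ ^ 2)
    rw [e1]
    linarith
  have hQ : HasDerivWithinAt (fun a => (1 - a ^ N) * quotientB N σ a) (-N) s 1 := by
    have := hasDerivWithinAt_mul_of_eq_zero (hpow.const_sub 1) (by simp)
      (continuousAt_quotientB_one hN σ).continuousWithinAt
    rwa [quotientB_one hN, mul_one] at this
  have hnum : HasDerivWithinAt (fun a => a ^ N + (1 - a ^ N) * quotientB N σ a) 0 s 1 := by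
    convert! hpow.add hQ using 1
    simp
  -- The three contributions are `N K`, `N (J - K)` and `-N J`, which cancel; the derivative of `J`
  -- drops out because its factor `1 - a^N` vanishes at `1`.
  have hden : HasDerivWithinAt (fun a => a ^ N * besselK N (σ ^ 2 * a ^ 2)
      + (1 - a ^ N) * quotientB N σ a * besselJ N (σ ^ 2 * a ^ 2)) 0 s 1 := by
    convert! (hpow.mul hKd).add (hQ.mul hJ) using 1
    simp
    ring
  have hβ : HasDerivWithinAt (coeffA N σ) 0 s 1 := by
    have := (hnum.div hden (by simpa using hK.ne')).const_mul (1 / σ ^ 4)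
    convert! this using 1
    simp
  -- As `β` is stationary, the `J` terms cancel and what remains is a multiple of `β σ² K / (2N) -
  -- c`, zero by the clamping value of `β` at `a = 1`.
  have hV : HasDerivWithinAt
      (fun a => plateVolume N σ (1 / (2 * N * σ ^ 2)) (coeffA N σ a) a) 0 s 1 := by
    have h2 := hsq.hasDerivWithinAt (s := s)
    have h := (hpow.const_mul 2).mul
      ((((h2.div_const (2 * ((N : ℝ) + 2))).sub (h2.div_const (2 * (N : ℝ)))).const_mul
        (1 / (2 * N * σ ^ 2))).add ((hβ.div_const (2 * (N : ℝ))).mul (hKd.sub hJ)))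
    convert! h using 1
    simp [coeffA_one]
    field_simp
    ring
  have := (hV.const_mul (-(1 / 2))).mul_const (sphereArea N)
  convert! this using 1
  simp

lemma exists_pos_forall_bessel_pos (hN : 1 ≤ N) : ∃ η : ℝ, 0 < η ∧
    ∀ t, |t| < η → 0 < besselJ N t ∧ 0 < besselK N t := by
  have h1 : ∀ᶠ t in 𝓝 (0 : ℝ), 0 < besselJ N t :=
    (contDiff_besselJ hN).continuous.continuousAt.eventually
      (lt_mem_nhds (by rw [besselJ, normBessel_zero]; exact one_pos))
  have h2 : ∀ᶠ t in 𝓝 (0 : ℝ), 0 < besselK N t :=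
    (contDiff_besselK hN).continuous.continuousAt.eventually
      (lt_mem_nhds (by rw [besselK, normBessel_zero]; exact one_pos))
  obtain ⟨η, hη, h⟩ := Metric.eventually_nhds_iff.1 (h1.and h2)
  exact ⟨η, hη, fun t ht => h (by simpa using ht)⟩

end TwoBall

end

theorem mainTheorem6 (N : ℕ) (hN : 1 ≤ N) :
    ∃ σN : ℝ, 0 < σN ∧ ∀ σ : ℝ, 0 < σ → σ ≤ σN →
      (∀ a ∈ Set.Ioc (0 : ℝ) 1,
        IsLeast (TwoBall.energyValues N a σ) (TwoBall.twoBallEnergy N a σ)) ∧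
      HasDerivWithinAt (fun a => TwoBall.twoBallEnergy N a σ) 0 (Set.Ioc (0 : ℝ) 1) 1 := by
  obtain ⟨η, hη, hpos⟩ := TwoBall.exists_pos_forall_bessel_pos hN
  -- The bound `1 / 2` makes the quadratic form nonnegative on balls of radius at most `1`. Together
  -- with `η / 2` it gives `σ² ≤ η / 4 < η`, so `J` and `K` are positive on `[0, σ²]`.
  refine ⟨min (1 / 2) (η / 2), by positivity, fun σ hσ hσN => ?_⟩
  have h1 : σ ≤ 1 / 2 := hσN.trans (min_le_left _ _)
  have h2 : σ ≤ η / 2 := hσN.trans (min_le_right _ _)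
  have hσ2 : σ ^ 2 < η := by nlinarith
  have hσ1 : 4 * σ ^ 2 ≤ 1 := by nlinarith
  have hpos' : ∀ t ∈ Set.Icc 0 (σ ^ 2), 0 < TwoBall.besselJ N t ∧ 0 < TwoBall.besselK N t :=
    fun t ht => hpos t (by rw [abs_of_nonneg ht.1]; exact ht.2.trans_lt hσ2)
  have hK := (hpos' _ (Set.right_mem_Icc.2 (sq_nonneg σ))).2
  have hleast : ∀ a ∈ Set.Ioc (0 : ℝ) 1,
      IsLeast (TwoBall.energyValues N a σ) (TwoBall.energyFormula N σ a) := by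
    rintro a ⟨ha0, ha1⟩
    rcases ha1.lt_or_eq with ha | rfl
    · exact TwoBall.isLeast_energyValues_of_lt_one hN hσ hσ1 hpos' ha0 ha
    · exact TwoBall.isLeast_energyValues_one hN hσ hσ1 hK
  have heq : ∀ a ∈ Set.Ioc (0 : ℝ) 1, TwoBall.twoBallEnergy N a σ = TwoBall.energyFormula N σ a :=
    fun a ha => (hleast a ha).csInf_eq
  refine ⟨fun a ha => by rw [heq a ha]; exact hleast a ha, ?_⟩
  exact (TwoBall.hasDerivWithinAt_energyFormula hN hσ hK _).congr heq (heq 1 (by simp))
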